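/- **Setting.** A *metric group* is a group $G$ with a complete bi-invariant metric $d\le 1$, viewed as a continuous metric structure in the language $(d,\cdot,{}^{-1},1)$. An infinite-dimensional complex Hilbert space $\mathbf H$ is viewed as the many-sorted metric structure $(\{B_n\}_{n\in\omega},0,\{I_{mn}\}_{m<n},\{\lambda_c\}_{c\in\mathbb C},+,-,\langle\,\rangle_{Re},\langle\,\rangle_{Im})$, where $B_n$ is the ball of vectors of norm $\le n$, $I_{mn}:B_m\to B_n$ is the inclusion, $\lambda_c:B_m\to B_{km}$ is multiplication by $c$ (with $k\ge 1$ the integer such that $k-1\le |c|<k$), and $+,-:B_n\times B_n\to B_{2n}$. For a unitary representation of $G$ on $\mathbf H$ such that the action $G\times B_1\to B_1$ is uniformly continuous, $A(G,\mathbf H)$ denotes the metric structure formed by $G$, $\mathbf H$ and the action maps $\circ_m:G\times B_m\to B_m$. Let $F$ be a continuity modulus, i.e. a function with $F(\varepsilon)>0$ for all $\varepsilon>0$. For rational $\delta\in(0,1)$ let $\mathcal K^{NIV}_\delta(F)$ be the class of all structures (isomorphic to one) of the form $A(G,\mathbf H)$ such that * $d(g,h)<F(\varepsilon)$ implies $\|g\circ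 v-h\circ v\|<\varepsilon$ for all $\varepsilon>0$, $g,h\in G$, $v\in B_1$; * for all integers $k,m,n\ge 1$, with $K_\delta=\{g\in G: d(1,g)\le\delta\}$, $$\sup_{x_1,\dots,x_k\in G}\ \inf_{v\in B_m}\ \sup_{x\in\bigcup_i x_iK_\delta}\max\Big(\max\big(\|x\circ v-v\|-\tfrac1n,\,0\big),\ \big|1-\|v\|\big|\Big)=0;$$ * (NIV) $\displaystyle\sup_{v\in B_1}\inf_{x\in G}\max\Big(1-\big(\|x\circ v-v\|+\big|1-\|v\|\big|\big),\,0\Big)\le 0.$ A *substructure* of a metric structure is given by nonempty closed subsets of the sorts which are closed under the operations; it is *elementary* ($\preceq$) if every formula of continuous first-order logic has the same value in it as in the whole structure at all tuples from the substructure. **Proposition.** Let $A(G,\mathbf H)\in\bigcup\{\mathcal K^{NIV}_\delta(F):\delta\in(0,1)\cap\mathbb Q\}$ with $G$ locally compact, and let $N\preceq A(G,\mathbf H)$. Then $N\in\bigcup\{\mathcal K^{NIV}_\delta(F):\delta\in(0,1)\cap\mathbb Q\}$. Moreover there are a subgroup $G_0\le G$, which is a metric group under the metric of $G$, and a closed $G_0$-invariant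 linear subspace $\mathbf H_0\subseteq\mathbf H$ such that $N=A(G_0,\mathbf H_0)$ for the restricted action, $G_0\preceq G$ (in the language of metric groups), $\mathbf H_0\preceq\mathbf H$ (in the language of Hilbert spaces), and $G_0$ is locally compact. -/

import Mathlib

universe u

/-! ## Many-sorted continuous first-order logic -/

/-- A many-sorted continuous signature: sorts with a bound on their diameter, function symbols,
and predicate symbols with values in a given compact interval. The metric of each sort is a
logical symbol. -/
structure CLSig where
  /-- the sorts -/
  Srt : Type
  /-- bound for the metric on each sort -/
  diam : Srt → ℝ
  /-- function symbols (constants are the symbols of arity `0`) -/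
  Fn : Type
  arity : Fn → ℕ
  dom : (f : Fn) → Fin (arity f) → Srt
  cod : Fn → Srt
  /-- predicate symbols -/
  Rel : Type
  relArity : Rel → ℕ
  relDom : (r : Rel) → Fin (relArity r) → Srt
  lo : Rel → ℝ
  hi : Rel → ℝ

/-- A metric structure: every sort is a nonempty complete metric space of bounded diameter,
operations and predicates are uniformly continuous. -/
structure MStr (L : CLSig) where
  carrier : L.Srt → Type u
  metric : ∀ s, MetricSpace (carrier s)
  complete : ∀ s, CompleteSpace (carrier s)
  nonempty : ∀ s, Nonempty (carrier s)
  dist_le : ∀ s (x y : carrier s), dist x y ≤ L.diam s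
  fn : (f : L.Fn) → (∀ i, carrier (L.dom f i)) → carrier (L.cod f)
  fn_uc : ∀ f, UniformContinuous (fn f)
  rel : (r : L.Rel) → (∀ i, carrier (L.relDom r i)) → ℝ
  rel_uc : ∀ r, UniformContinuous (rel r)
  rel_mem : ∀ r x, rel r x ∈ Set.Icc (L.lo r) (L.hi r)

attribute [instance] MStr.metric MStr.complete MStr.nonempty

/-- Terms; `var s n` is the `n`-th variable of sort `s`. -/
inductive CLTerm (L : CLSig) : L.Srt → Type
  | var (s : L.Srt) (n : ℕ) : CLTerm L s
  | app (f : L.Fn) (args : ∀ i, CLTerm L (L.dom f i)) : CLTerm L (L.cod f)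

/-- Formulas. -/
inductive CLFormula (L : CLSig) : Type
  | zero : CLFormula L
  | one : CLFormula L
  | dist (s : L.Srt) (t₁ t₂ : CLTerm L s) : CLFormula L
  | rel (r : L.Rel) (args : ∀ i, CLTerm L (L.relDom r i)) : CLFormula L
  | half (φ : CLFormula L) : CLFormula L
  | monus (φ ψ : CLFormula L) : CLFormula L
  | min (φ ψ : CLFormula L) : CLFormula L
  | max (φ ψ : CLFormula L) : CLFormula L
  | absDiff (φ ψ : CLFormula L) : CLFormula L
  | neg (φ : CLFormula L) : CLFormula L
  | add (φ ψ : CLFormula L) : CLFormula L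
  | sup (s : L.Srt) (n : ℕ) (φ : CLFormula L) : CLFormula L
  | inf (s : L.Srt) (n : ℕ) (φ : CLFormula L) : CLFormula L

/-- Valuations of all variables in a structure. -/
abbrev MStr.Val {L : CLSig} (M : MStr.{u} L) : Type u :=
  ∀ p : L.Srt × ℕ, M.carrier p.1

/-- Value of a term. -/
def CLTerm.eval {L : CLSig} (M : MStr.{u} L) (v : M.Val) : {s : L.Srt} → CLTerm L s → M.carrier s
  | _, .var s n => v (s, n)
  | _, .app f args => M.fn f (fun i => (args i).eval M v)

open Classical in
/-- Value of a formula. Since the sorts and predicates have different bounds, no fixed truncation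
is built into `neg` and `add`; the truncated connectives are compositions of these with `min`
and `max`. Every formula takes values in a bounded interval, so the suprema and infima are genuine. -/
noncomputable def CLFormula.eval {L : CLSig} (M : MStr.{u} L) : CLFormula L → M.Val → ℝ
  | .zero, _ => 0
  | .one, _ => 1
  | .dist _ t₁ t₂, v => Dist.dist (t₁.eval M v) (t₂.eval M v)
  | .rel r args, v => M.rel r (fun i => (args i).eval M v)
  | .half φ, v => φ.eval M v / 2
  | .monus φ ψ, v => Max.max (φ.eval M v - ψ.eval M v) 0
  | .min φ ψ, v => Min.min (φ.eval M v) (ψ.eval M v)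
  | .max φ ψ, v => Max.max (φ.eval M v) (ψ.eval M v)
  | .absDiff φ ψ, v => |φ.eval M v - ψ.eval M v|
  | .neg φ, v => 1 - φ.eval M v
  | .add φ ψ, v => φ.eval M v + ψ.eval M v
  | .sup s n φ, v => ⨆ a : M.carrier s, φ.eval M (Function.update v (s, n) a)
  | .inf s n φ, v => ⨅ a : M.carrier s, φ.eval M (Function.update v (s, n) a)

/-- A family of maps between the sorts is an elementary embedding if it preserves the values of
all formulas at all tuples. -/
def IsElementaryEmb {L : CLSig} (M N : MStr.{u} L) (e : ∀ s, M.carrier s → N.carrier s) : Prop :=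
  ∀ (φ : CLFormula L) (v : M.Val), φ.eval M v = φ.eval N (fun p => e p.1 (v p))

/-- Substructures (complete, hence closed, subsets of the sorts, closed under the operations). -/
structure CLSubstr {L : CLSig} (M : MStr.{u} L) where
  carrier : ∀ s, Set (M.carrier s)
  nonempty : ∀ s, (carrier s).Nonempty
  isClosed : ∀ s, IsClosed (carrier s)
  fn_mem : ∀ (f : L.Fn) (x : ∀ i, M.carrier (L.dom f i)),
    (∀ i, x i ∈ carrier (L.dom f i)) → M.fn f x ∈ carrier (L.cod f)

lemma uniformContinuous_pi_val {n : ℕ} {α : Fin n → Type u} [∀ i, UniformSpace (α i)]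
    (S : ∀ i, Set (α i)) :
    UniformContinuous (fun (x : ∀ i, S i) (i : Fin n) => (x i : α i)) :=
  uniformContinuous_pi.2 fun i =>
    uniformContinuous_subtype_val.comp (Pi.uniformContinuous_proj _ i)

/-- A substructure with the induced metrics, operations and predicates. -/
def CLSubstr.toStr {L : CLSig} {M : MStr.{u} L} (N : CLSubstr M) : MStr.{u} L where
  carrier s := N.carrier s
  metric _ := inferInstance
  complete s := (N.isClosed s).completeSpace_coe
  nonempty s := (N.nonempty s).to_subtype
  dist_le s x y := M.dist_le s x y
  fn f x := ⟨M.fn f (fun i => (x i).1), N.fn_mem f _ fun i => (x i).2⟩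
  fn_uc f := ((M.fn_uc f).comp
    (uniformContinuous_pi_val fun i => N.carrier (L.dom f i))).subtype_mk _
  rel r x := M.rel r (fun i => (x i).1)
  rel_uc r := (M.rel_uc r).comp (uniformContinuous_pi_val fun i => N.carrier (L.relDom r i))
  rel_mem r _ := M.rel_mem r _

/-- Elementary substructures. -/
def CLSubstr.IsElementary {L : CLSig} {M : MStr.{u} L} (N : CLSubstr M) : Prop :=
  IsElementaryEmb N.toStr M (fun _ x => x.1)

/-- Isomorphisms of metric structures. -/
structure MStr.Iso {L : CLSig} (M N : MStr.{u} L) where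
  toEquiv : ∀ s, M.carrier s ≃ N.carrier s
  dist_eq : ∀ s (x y : M.carrier s), dist (toEquiv s x) (toEquiv s y) = dist x y
  map_fn : ∀ f (x : ∀ i, M.carrier (L.dom f i)),
    toEquiv _ (M.fn f x) = N.fn f (fun i => toEquiv _ (x i))
  map_rel : ∀ r (x : ∀ i, M.carrier (L.relDom r i)),
    M.rel r x = N.rel r (fun i => toEquiv _ (x i))

/-- The pair `(a, b)` as a (dependent) tuple of length two. -/
def tuple₂ {α : Fin 2 → Type u} (a : α 0) (b : α 1) : ∀ i, α i
  | 0 => a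
  | 1 => b

/-! ## Metric groups -/

/-- Function symbols of the language of metric groups. -/
inductive GrpFn
  | mul
  | inv
  | one

/-- The signature `(d, ·, ⁻¹, 1)`; one sort of diameter at most `1`. -/
abbrev grpSig : CLSig where
  Srt := Unit
  diam _ := 1
  Fn := GrpFn
  arity
    | .mul => 2
    | .inv => 1
    | .one => 0
  dom _ _ := ()
  cod _ := ()
  Rel := Empty
  relArity := Empty.elim
  relDom r := r.elim
  lo := Empty.elim
  hi := Empty.elim

/-- Metric groups: the metric is complete, bi-invariant and bounded by `1`. -/
class IsCLGroup (G : Type u) [Group G] [MetricSpace G] : Prop where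
  dist_mul_left : ∀ a x y : G, dist (a * x) (a * y) = dist x y
  dist_mul_right : ∀ a x y : G, dist (x * a) (y * a) = dist x y
  dist_le_one : ∀ x y : G, dist x y ≤ 1
  complete : CompleteSpace G

section Grp

variable (G : Type u) [Group G] [MetricSpace G] [IsCLGroup G]

lemma IsCLGroup.dist_mul_mul_le (a b c d : G) :
    dist (a * b) (c * d) ≤ dist a c + dist b d := by
  refine (dist_triangle _ (c * b) _).trans (le_of_eq ?_)
  rw [IsCLGroup.dist_mul_right, IsCLGroup.dist_mul_left]

lemma IsCLGroup.dist_inv (a b : G) : dist a⁻¹ b⁻¹ = dist a b := by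
  rw [← IsCLGroup.dist_mul_left a, ← IsCLGroup.dist_mul_right b]
  simp [dist_comm]

/-- The operations of a group. -/
def grpOp (f : GrpFn) (x : Fin (grpSig.arity f) → G) : G :=
  match f, x with
  | .mul, x => x (0 : Fin 2) * x (1 : Fin 2)
  | .inv, x => (x (0 : Fin 1))⁻¹
  | .one, _ => 1

/-- A metric group as a metric structure. -/
def grpStr : MStr.{u} grpSig where
  carrier _ := G
  metric _ := inferInstance
  complete _ := IsCLGroup.complete
  nonempty _ := ⟨(1 : G)⟩
  dist_le _ x y := IsCLGroup.dist_le_one x y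
  fn := grpOp G
  fn_uc f := by
    cases f with
    | mul =>
      refine LipschitzWith.uniformContinuous (K := 2) (LipschitzWith.of_dist_le_mul ?_)
      intro x y
      change Fin 2 → G at x
      change Fin 2 → G at y
      have h0 := dist_le_pi_dist x y 0
      have h1 := dist_le_pi_dist x y 1
      have h := IsCLGroup.dist_mul_mul_le G (x 0) (x 1) (y 0) (y 1)
      change dist (x 0 * x 1) (y 0 * y 1) ≤ 2 * dist x y
      linarith
    | inv =>
      refine LipschitzWith.uniformContinuous (K := 1) (LipschitzWith.of_dist_le_mul ?_)
      intro x y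
      change Fin 1 → G at x
      change Fin 1 → G at y
      have h0 := dist_le_pi_dist x y 0
      have h := IsCLGroup.dist_inv G (x 0) (y 0)
      change dist (x 0)⁻¹ (y 0)⁻¹ ≤ 1 * dist x y
      linarith
    | one => exact uniformContinuous_const
  rel r := r.elim
  rel_uc r := r.elim
  rel_mem r := r.elim

variable {G}

/-- The inclusion of a subgroup, as a map of metric structures. -/
def grpIncl (G₀ : Subgroup G) [IsCLGroup G₀] (s : grpSig.Srt) :
    (grpStr G₀).carrier s → (grpStr G).carrier s :=
  fun g : G₀ => (g : G)

end Grp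

/-! ## Complex Hilbert spaces -/

/-- Function symbols of the language of complex Hilbert spaces: `0`, the inclusions
`I_{mn} : B_m → B_n`, the scalar multiplications `λ_c : B_m → B_{km}`, and
`+, - : B_n × B_n → B_{2n}`. -/
inductive HilbFn
  | zero
  | incl (m n : ℕ) (h : m < n)
  | smul (c : ℂ) (m : ℕ)
  | add (n : ℕ)
  | sub (n : ℕ)

/-- Real and imaginary part of the inner product on `B_n`. -/
inductive HilbRel
  | re (n : ℕ)
  | im (n : ℕ)

/-- The unique integer `k ≥ 1` with `k - 1 ≤ |c| < k`. -/
noncomputable def scalarIdx (c : ℂ) : ℕ := ⌊‖c‖⌋₊ + 1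

/-- The signature of complex Hilbert spaces; the sort `n` is the ball `B_n`. -/
noncomputable abbrev hilbSig : CLSig where
  Srt := ℕ
  diam n := 2 * n
  Fn := HilbFn
  arity
    | .zero => 0
    | .incl _ _ _ => 1
    | .smul _ _ => 1
    | .add _ => 2
    | .sub _ => 2
  dom
    | .zero => fun _ => 0
    | .incl m _ _ => fun _ => m
    | .smul _ m => fun _ => m
    | .add n => fun _ => n
    | .sub n => fun _ => n
  cod
    | .zero => 0
    | .incl _ n _ => n
    | .smul c m => scalarIdx c * m
    | .add n => 2 * n
    | .sub n => 2 * n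
  Rel := HilbRel
  relArity _ := 2
  relDom
    | .re n => fun _ => n
    | .im n => fun _ => n
  lo
    | .re n => -(n : ℝ) ^ 2
    | .im n => -(n : ℝ) ^ 2
  hi
    | .re n => (n : ℝ) ^ 2
    | .im n => (n : ℝ) ^ 2

section Hilb

variable (H : Type u) [NormedAddCommGroup H]

/-- The ball of vectors of norm at most `n`. -/
abbrev HBall (n : ℕ) : Type u := {v : H // ‖v‖ ≤ n}

lemma HBall.completeSpace [CompleteSpace H] (n : ℕ) : CompleteSpace (HBall H n) :=
  (isClosed_le continuous_norm continuous_const : IsClosed {v : H | ‖v‖ ≤ n}).completeSpace_coe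

lemma HBall.dist_le (n : ℕ) (x y : HBall H n) : dist x y ≤ 2 * n := by
  have hx := x.2
  have hy := y.2
  have h := norm_sub_le x.1 y.1
  rw [Subtype.dist_eq, dist_eq_norm]
  linarith

lemma HBall.uc_proj {k : ℕ} (n : ℕ) (i : Fin k) :
    UniformContinuous (fun x : Fin k → HBall H n => (x i).1) :=
  uniformContinuous_subtype_val.comp (Pi.uniformContinuous_proj (fun _ : Fin k => HBall H n) i)

variable [InnerProductSpace ℂ H]

/-- The operations of a Hilbert space on its balls. -/
noncomputable def hilbOp (f : HilbFn) (x : ∀ i, HBall H (hilbSig.dom f i)) :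
    HBall H (hilbSig.cod f) :=
  match f, x with
  | .zero, _ => ⟨0, norm_zero.trans_le (Nat.cast_nonneg _)⟩
  | .incl m n h, x => ⟨(x (0 : Fin 1)).1,
      (x (0 : Fin 1)).2.trans (Nat.cast_le.2 (le_of_lt h : m ≤ n))⟩
  | .smul c m, x => ⟨c • (x (0 : Fin 1)).1, by
      change ‖c • (x (0 : Fin 1)).1‖ ≤ ((scalarIdx c * m : ℕ) : ℝ)
      have hc : ‖c‖ ≤ (scalarIdx c : ℝ) := by
        unfold scalarIdx
        push_cast
        exact (Nat.lt_floor_add_one _).le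
      have hx : ‖(x (0 : Fin 1)).1‖ ≤ (m : ℝ) := (x (0 : Fin 1)).2
      rw [norm_smul]
      push_cast
      exact mul_le_mul hc hx (norm_nonneg _) (Nat.cast_nonneg _)⟩
  | .add n, x => ⟨(x (0 : Fin 2)).1 + (x (1 : Fin 2)).1, by
      change ‖(x (0 : Fin 2)).1 + (x (1 : Fin 2)).1‖ ≤ ((2 * n : ℕ) : ℝ)
      have h0 : ‖(x (0 : Fin 2)).1‖ ≤ (n : ℝ) := (x (0 : Fin 2)).2
      have h1 : ‖(x (1 : Fin 2)).1‖ ≤ (n : ℝ) := (x (1 : Fin 2)).2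
      have h := norm_add_le (x (0 : Fin 2)).1 (x (1 : Fin 2)).1
      push_cast
      linarith⟩
  | .sub n, x => ⟨(x (0 : Fin 2)).1 - (x (1 : Fin 2)).1, by
      change ‖(x (0 : Fin 2)).1 - (x (1 : Fin 2)).1‖ ≤ ((2 * n : ℕ) : ℝ)
      have h0 : ‖(x (0 : Fin 2)).1‖ ≤ (n : ℝ) := (x (0 : Fin 2)).2
      have h1 : ‖(x (1 : Fin 2)).1‖ ≤ (n : ℝ) := (x (1 : Fin 2)).2
      have h := norm_sub_le (x (0 : Fin 2)).1 (x (1 : Fin 2)).1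
      push_cast
      linarith⟩

/-- The predicates of a Hilbert space on its balls. -/
noncomputable def hilbRel (r : HilbRel) (x : ∀ i, HBall H (hilbSig.relDom r i)) : ℝ :=
  match r, x with
  | .re _, x => (inner ℂ (x (0 : Fin 2)).1 (x (1 : Fin 2)).1).re
  | .im _, x => (inner ℂ (x (0 : Fin 2)).1 (x (1 : Fin 2)).1).im

lemma norm_inner_sub_inner_le {n : ℕ} (a b c d : HBall H n) :
    ‖inner ℂ a.1 b.1 - inner ℂ c.1 d.1‖ ≤ n * dist a c + n * dist b d := by
  have e : inner ℂ a.1 b.1 - inner ℂ c.1 d.1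
      = inner ℂ (a.1 - c.1) b.1 + inner ℂ c.1 (b.1 - d.1) := by
    rw [inner_sub_left, inner_sub_right]; ring
  rw [e]
  refine (norm_add_le _ _).trans (add_le_add ?_ ?_)
  · refine (norm_inner_le_norm _ _).trans ?_
    rw [Subtype.dist_eq, dist_eq_norm, mul_comm]
    exact mul_le_mul_of_nonneg_right b.2 (norm_nonneg _)
  · refine (norm_inner_le_norm _ _).trans ?_
    rw [Subtype.dist_eq, dist_eq_norm]
    exact mul_le_mul_of_nonneg_right c.2 (norm_nonneg _)

lemma norm_inner_le_sq {n : ℕ} (a b : HBall H n) : ‖inner ℂ a.1 b.1‖ ≤ (n : ℝ) ^ 2 := by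
  refine (norm_inner_le_norm _ _).trans ?_
  rw [sq]
  exact mul_le_mul a.2 b.2 (norm_nonneg _) (Nat.cast_nonneg _)

lemma HBall.uc_inner (n : ℕ) :
    UniformContinuous (fun x : Fin 2 → HBall H n => inner ℂ (x 0).1 (x 1).1) := by
  refine LipschitzWith.uniformContinuous (K := 2 * n) (LipschitzWith.of_dist_le_mul ?_)
  intro x y
  have h0 := mul_le_mul_of_nonneg_left (dist_le_pi_dist x y 0) (Nat.cast_nonneg (α := ℝ) n)
  have h1 := mul_le_mul_of_nonneg_left (dist_le_pi_dist x y 1) (Nat.cast_nonneg (α := ℝ) n)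
  have h := norm_inner_sub_inner_le H (x 0) (x 1) (y 0) (y 1)
  rw [dist_eq_norm]
  push_cast
  linarith

/-- A complex Hilbert space as a metric structure. -/
noncomputable def hilbStr [CompleteSpace H] : MStr.{u} hilbSig where
  carrier n := HBall H n
  metric n := inferInstanceAs (MetricSpace (HBall H n))
  complete n := HBall.completeSpace H n
  nonempty _ := ⟨⟨(0 : H), norm_zero.trans_le (Nat.cast_nonneg _)⟩⟩
  dist_le n x y := HBall.dist_le H n x y
  fn := hilbOp H
  fn_uc f := match f with
    | .zero => uniformContinuous_const (α := Fin 0 → HBall H 0)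
        (b := (⟨0, norm_zero.trans_le (Nat.cast_nonneg _)⟩ : HBall H 0))
    | .incl m _ _ => (HBall.uc_proj H m (0 : Fin 1)).subtype_mk _
    | .smul c m => ((uniformContinuous_const_smul c).comp
        (HBall.uc_proj H m (0 : Fin 1))).subtype_mk _
    | .add n => ((HBall.uc_proj H n (0 : Fin 2)).add (HBall.uc_proj H n (1 : Fin 2))).subtype_mk _
    | .sub n => ((HBall.uc_proj H n (0 : Fin 2)).sub (HBall.uc_proj H n (1 : Fin 2))).subtype_mk _
  rel := hilbRel H
  rel_uc r := match r with
    | .re n => Complex.uniformContinuous_re.comp (HBall.uc_inner H n)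
    | .im n => Complex.uniformContinuous_im.comp (HBall.uc_inner H n)
  rel_mem r x := match r, x with
    | .re _, x => abs_le.1 ((Complex.abs_re_le_norm _).trans
        (norm_inner_le_sq H (x (0 : Fin 2)) (x (1 : Fin 2))))
    | .im _, x => abs_le.1 ((Complex.abs_im_le_norm _).trans
        (norm_inner_le_sq H (x (0 : Fin 2)) (x (1 : Fin 2))))

variable {H}

/-- The inclusion of a subspace, as a map of metric structures. -/
def hilbIncl [CompleteSpace H] (H₀ : Submodule ℂ H) [CompleteSpace H₀] (n : hilbSig.Srt) :
    (hilbStr H₀).carrier n → (hilbStr H).carrier n :=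
  fun v : HBall H₀ n => (⟨(v.1 : H), v.2⟩ : HBall H n)

end Hilb

/-! ## Unitary representations as metric structures -/

/-- The union of the languages of metric groups and of Hilbert spaces together with
the action symbols `∘_m : G × B_m → B_m`. -/
noncomputable abbrev ghSig : CLSig where
  Srt := grpSig.Srt ⊕ hilbSig.Srt
  diam := Sum.elim grpSig.diam hilbSig.diam
  Fn := (grpSig.Fn ⊕ hilbSig.Fn) ⊕ ℕ
  arity
    | .inl (.inl f) => grpSig.arity f
    | .inl (.inr f) => hilbSig.arity f
    | .inr _ => 2
  dom
    | .inl (.inl f) => fun i => .inl (grpSig.dom f i)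
    | .inl (.inr f) => fun i => .inr (hilbSig.dom f i)
    | .inr m => fun i : Fin 2 => match i with
      | 0 => .inl ()
      | 1 => .inr m
  cod
    | .inl (.inl f) => .inl (grpSig.cod f)
    | .inl (.inr f) => .inr (hilbSig.cod f)
    | .inr m => .inr m
  Rel := hilbSig.Rel
  relArity := hilbSig.relArity
  relDom r i := .inr (hilbSig.relDom r i)
  lo := hilbSig.lo
  hi := hilbSig.hi

section GH

variable (G H : Type u) [Group G] [MetricSpace G] [NormedAddCommGroup H] [InnerProductSpace ℂ H]

/-- Unitary representations for which the action `G × B_1 → B_1` is uniformly continuous. -/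
structure UnitaryRep where
  toHom : G →* (H ≃ₗᵢ[ℂ] H)
  uc : ∀ ε > 0, ∃ η > 0, ∀ g h : G, dist g h < η →
    ∀ v : H, ‖v‖ ≤ 1 → ‖toHom g v - toHom h v‖ < ε

variable {G H}

lemma UnitaryRep.uc_ball (π : UnitaryRep G H) (m : ℕ) (ε : ℝ) (hε : 0 < ε) :
    ∃ η > 0, ∀ g h : G, dist g h < η →
      ∀ v : H, ‖v‖ ≤ m → ‖π.toHom g v - π.toHom h v‖ < ε := by
  have hm : (0 : ℝ) < m + 1 := by positivity
  obtain ⟨η, hη, h⟩ := π.uc (ε / (m + 1)) (by positivity)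
  refine ⟨η, hη, fun g g' hg v hv => ?_⟩
  have hn : ‖((m + 1 : ℝ) : ℂ)⁻¹‖ = (m + 1 : ℝ)⁻¹ := by
    rw [norm_inv, Complex.norm_real, Real.norm_of_nonneg hm.le]
  have h1 := h g g' hg (((m + 1 : ℝ) : ℂ)⁻¹ • v) (by
    rw [norm_smul, hn, inv_mul_le_iff₀ hm]; linarith)
  rw [map_smul, map_smul, ← smul_sub, norm_smul, hn, inv_mul_lt_iff₀ hm] at h1
  calc _ < _ := h1
    _ = ε := by field_simp

/-- The action of `G` on the ball `B_m`. -/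
def UnitaryRep.act (π : UnitaryRep G H) (m : ℕ) (g : G) (v : HBall H m) : HBall H m :=
  ⟨π.toHom g v.1, by rw [LinearIsometryEquiv.norm_map]; exact v.2⟩

lemma UnitaryRep.uc_act (π : UnitaryRep G H) (m : ℕ) :
    UniformContinuous (fun p : G × HBall H m => π.act m p.1 p.2) := by
  rw [Metric.uniformContinuous_iff]
  intro ε hε
  obtain ⟨η, hη, h⟩ := π.uc_ball m (ε / 2) (by positivity)
  refine ⟨min η (ε / 2), lt_min hη (by positivity), fun {x y} hxy => ?_⟩
  obtain ⟨g, v⟩ := x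
  obtain ⟨g', v'⟩ := y
  rw [Prod.dist_eq, max_lt_iff] at hxy
  obtain ⟨hg, hv⟩ := hxy
  have e1 := h g g' (hg.trans_le (min_le_left _ _)) v.1 v.2
  have e2 : dist (π.toHom g' v.1) (π.toHom g' v'.1) < ε / 2 := by
    rw [LinearIsometryEquiv.dist_map]
    exact hv.trans_le (min_le_right _ _)
  rw [← dist_eq_norm] at e1
  change dist (π.toHom g v.1) (π.toHom g' v'.1) < ε
  have := dist_triangle (π.toHom g v.1) (π.toHom g' v.1) (π.toHom g' v'.1)
  linarith

variable [IsCLGroup G] [CompleteSpace H]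

variable (G H)
/-- The sorts of `A(G, H)`: the group `G` and the balls of `H`. -/
def ghCarrier : ghSig.Srt → Type u
  | .inl s => (grpStr G).carrier s
  | .inr n => (hilbStr H).carrier n

variable {G H}

noncomputable instance ghMetric : ∀ s, MetricSpace (ghCarrier G H s)
  | .inl s => (grpStr G).metric s
  | .inr n => (hilbStr H).metric n

/-- The structure `A(G, H)` given by a unitary representation of `G` on `H`. -/
noncomputable def UnitaryRep.toStr (π : UnitaryRep G H) : MStr.{u} ghSig where
  carrier := ghCarrier G H
  metric := inferInstance
  complete
    | .inl s => (grpStr G).complete s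
    | .inr n => (hilbStr H).complete n
  nonempty
    | .inl s => (grpStr G).nonempty s
    | .inr n => (hilbStr H).nonempty n
  dist_le
    | .inl s => (grpStr G).dist_le s
    | .inr n => (hilbStr H).dist_le n
  fn
    | .inl (.inl f) => fun x => (grpStr G).fn f x
    | .inl (.inr f) => fun x => (hilbStr H).fn f x
    | .inr m => fun x => π.act m (x (0 : Fin 2)) (x (1 : Fin 2))
  fn_uc
    | .inl (.inl f) => (grpStr G).fn_uc f
    | .inl (.inr f) => (hilbStr H).fn_uc f
    | .inr m => (π.uc_act m).comp (UniformContinuous.prodMk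
        (Pi.uniformContinuous_proj (fun i => ghCarrier G H (ghSig.dom (.inr m) i)) (0 : Fin 2))
        (Pi.uniformContinuous_proj (fun i => ghCarrier G H (ghSig.dom (.inr m) i)) (1 : Fin 2)))
  rel r x := (hilbStr H).rel r x
  rel_uc r := (hilbStr H).rel_uc r
  rel_mem r x := (hilbStr H).rel_mem r x

end GH

/-! ## The classes of structures -/

namespace GH

/-- The group sort. -/
abbrev Grp (M : MStr.{u} ghSig) : Type u := M.carrier (.inl ())

/-- The sort `B_n`. -/
abbrev Ball (M : MStr.{u} ghSig) (n : ℕ) : Type u := M.carrier (.inr n)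

variable (M : MStr.{u} ghSig)

/-- Interpretation of `1`. -/
def one : Grp M := M.fn (.inl (.inl .one)) (fun i : Fin 0 => i.elim0)

/-- Interpretation of the multiplication. -/
def mul (x y : Grp M) : Grp M :=
  M.fn (.inl (.inl .mul)) (tuple₂ (α := fun _ => Grp M) x y)

/-- Interpretation of the action `∘_m`. -/
def act (m : ℕ) (x : Grp M) (v : Ball M m) : Ball M m :=
  M.fn (.inr m) (tuple₂ (α := fun i => M.carrier (ghSig.dom (.inr m) i)) x v)

/-- Interpretation of the subtraction `B_n × B_n → B_{2n}`. -/
def sub (n : ℕ) (v w : Ball M n) : Ball M (2 * n) :=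
  M.fn (.inl (.inr (.sub n))) (tuple₂ (α := fun _ => Ball M n) v w)

/-- The norm given by the inner product predicate. -/
noncomputable def nrm (n : ℕ) (v : Ball M n) : ℝ :=
  Real.sqrt (M.rel (.re n) (tuple₂ (α := fun _ => Ball M n) v v))

end GH

/-- The class of structures which arise, up to isomorphism, from a unitary action of a metric
group on an infinite-dimensional complex Hilbert space. -/
def KGH : Set (MStr.{u} ghSig) :=
  {M | ∃ (G H : Type u) (_ : Group G) (_ : MetricSpace G) (_ : IsCLGroup G)
    (_ : NormedAddCommGroup H) (_ : InnerProductSpace ℂ H) (_ : CompleteSpace H)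
    (π : UnitaryRep G H), ¬ FiniteDimensional ℂ H ∧ Nonempty (MStr.Iso M π.toStr)}

/-- The subclass in which `F` is a continuity modulus for the `G`-variable
of `G × B_1 → B_1`. -/
def KGHF (F : ℝ → ℝ) : Set (MStr.{u} ghSig) :=
  {M | M ∈ KGH ∧ ∀ ε > 0, ∀ g h : GH.Grp M, dist g h < F ε →
    ∀ v : GH.Ball M 1, dist (GH.act M 1 g v) (GH.act M 1 h v) < ε}

/-- The translate `x K_δ`, where `K_δ = {g : d(1, g) ≤ δ}`. -/
def GH.translate (M : MStr.{u} ghSig) (δ : ℚ) (x : GH.Grp M) : Set (GH.Grp M) :=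
  {y | ∃ g : GH.Grp M, dist (GH.one M) g ≤ δ ∧ y = GH.mul M x g}

/-- The class `K_δ(F)`: for all `k, m, n ≥ 1`,
`sup_{x_1, …, x_k} inf_{v ∈ B_m} sup_{x ∈ ⋃ x_i K_δ} max(‖x ∘ v - v‖ ∸ 1/n, |1 - ‖v‖|) = 0`. -/
def Kδ (F : ℝ → ℝ) (δ : ℚ) : Set (MStr.{u} ghSig) :=
  {M | M ∈ KGHF F ∧ ∀ k m n : ℕ, 1 ≤ k → 1 ≤ m → 1 ≤ n →
    (⨆ x : Fin k → GH.Grp M, ⨅ v : GH.Ball M m, ⨆ y : (⋃ i, GH.translate M δ (x i) : Set _),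
      max (max (GH.nrm M (2 * m) (GH.sub M m (GH.act M m y v) v) - 1 / (n : ℝ)) 0)
        |1 - GH.nrm M m v|) = 0}

/-- The condition
`sup_{v ∈ B_1} inf_{x ∈ G} (1 ∸ (‖x ∘ v - v‖ + |1 - ‖v‖|)) ≤ 0`. -/
def NIV (M : MStr.{u} ghSig) : Prop :=
  (⨆ v : GH.Ball M 1, ⨅ x : GH.Grp M,
    max (1 - (GH.nrm M (2 * 1) (GH.sub M 1 (GH.act M 1 x v) v) + |1 - GH.nrm M 1 v|)) 0) ≤ 0

/-- The class `K^NIV_δ(F)`. -/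
def KNIV (F : ℝ → ℝ) (δ : ℚ) : Set (MStr.{u} ghSig) :=
  {M | M ∈ Kδ F δ ∧ NIV M}

/-- The union of the classes `K^NIV_δ(F)` over rational `δ ∈ (0, 1)`. -/
def KNIVUnion (F : ℝ → ℝ) : Set (MStr.{u} ghSig) :=
  ⋃ δ ∈ {δ : ℚ | 0 < δ ∧ δ < 1}, KNIV F δ

/-! ## Elementary embeddings -/

section Logic

variable {L : CLSig}

/-! Take `G₀` to be the group sort of `N` and `H₀` the union of the balls of `N`. Closure under the
operations makes these a subgroup and an invariant linear subspace. For `N` to be `A(G₀, H₀)`, each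
sort `B_n` of `N` must be all of `H₀ ∩ B_n`, and this uses elementarity (`mem_ball`). Once `N` is
identified with the restricted representation (`IsElementary.iso`), `G₀ ≼ G` and `H₀ ≼ H` follow
because formulas of either sublanguage are formulas of the full one.

The tool for the axioms is `exists_mem_of_forall_exists`: the infimum over one unknown of the
maximum of finitely many formulas has the same value in `N` and in `A(G, H)`, so a finite system of
conditions with parameters in `N` that is approximately solvable in `A(G, H)` is approximately
solvable in `N`. It yields `mem_ball` (approximate a vector by elements of a smaller ball, then use
closedness), the infinite dimension of `H₀` (a vector far from a finite net of a compact unit ball)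
and NIV (one condition on `x` for each `v`).

Almost invariance over the sets `x_i K_δ` involves infinitely many conditions on `v`, and here local
compactness enters. After shrinking `δ` to some `δ'` with `K_δ'` compact, `K_δ' ∩ G₀` has a finite
net in `G₀`. Almost invariance at the net points is a finite system, and uniform continuity of the
action extends it to the whole translates. This is why `δ` may change and the statement concerns the
union over `δ`. -/

lemma CLFormula.eval_sup [DecidableEq (L.Srt × ℕ)] (M : MStr.{u} L) (s : L.Srt) (n : ℕ)
    (φ : CLFormula L) (v : M.Val) :
    (CLFormula.sup s n φ).eval M v = ⨆ a, φ.eval M (Function.update v (s, n) a) := by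
  -- `eval` updates valuations with the classical decidability instance; `congr!` identifies it with
  -- the given one.
  refine iSup_congr fun a => congrArg _ ?_
  congr!

lemma CLFormula.eval_inf [DecidableEq (L.Srt × ℕ)] (M : MStr.{u} L) (s : L.Srt) (n : ℕ)
    (φ : CLFormula L) (v : M.Val) :
    (CLFormula.inf s n φ).eval M v = ⨅ a, φ.eval M (Function.update v (s, n) a) := by
  refine iInf_congr fun a => congrArg _ ?_
  congr!

/-- The maximum of `0` and finitely many formulas. -/
def CLFormula.maxList : List (CLFormula L) → CLFormula L
  | [] => .zero
  | φ :: l => .max φ (maxList l)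

lemma CLFormula.eval_maxList_nonneg (M : MStr.{u} L) (l : List (CLFormula L)) (v : M.Val) :
    0 ≤ (maxList l).eval M v := by
  induction l with
  | nil => exact le_rfl
  | cons φ l ih => exact ih.trans (le_max_right _ _)

lemma CLFormula.eval_maxList_le_iff (M : MStr.{u} L) (l : List (CLFormula L)) (v : M.Val)
    {c : ℝ} (hc : 0 ≤ c) : (maxList l).eval M v ≤ c ↔ ∀ φ ∈ l, φ.eval M v ≤ c := by
  induction l with
  | nil => simpa [maxList, CLFormula.eval] using hc
  | cons φ l ih =>
    rw [List.forall_mem_cons, ← ih]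
    exact max_le_iff

/-- In an elementary substructure, a finite system of conditions `φ ≤ 0` with one unknown and
parameters from the substructure is approximately solvable if it is so in the whole structure. -/
lemma CLSubstr.IsElementary.exists_mem_of_forall_exists
    [DecidableEq (L.Srt × ℕ)] {M : MStr.{u} L} {N : CLSubstr M}
    (hN : N.IsElementary) (w : M.Val) (hw : ∀ p, w p ∈ N.carrier p.1)
    (l : List (CLFormula L)) (s : L.Srt) (n : ℕ)
    (h : ∀ ε > 0, ∃ a : M.carrier s, ∀ φ ∈ l, φ.eval M (Function.update w (s, n) a) ≤ ε) :
    ∀ ε > 0, ∃ a ∈ N.carrier s, ∀ φ ∈ l, φ.eval M (Function.update w (s, n) a) ≤ ε := by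
  intro ε hε
  let w' : N.toStr.Val := fun p => ⟨w p, hw p⟩
  have key := hN (.inf s n (.maxList l)) w'
  have hM : (CLFormula.inf s n (.maxList l)).eval M w ≤ 0 := by
    refine le_of_forall_pos_le_add fun η hη => ?_
    obtain ⟨a, ha⟩ := h η hη
    rw [zero_add, CLFormula.eval_inf]
    refine ciInf_le_of_le ⟨0, ?_⟩ a ?_
    · rintro _ ⟨b, rfl⟩
      exact CLFormula.eval_maxList_nonneg _ _ _
    · exact (CLFormula.eval_maxList_le_iff M l _ hη.le).2 ha
  have hlt : (CLFormula.inf s n (.maxList l)).eval N.toStr w' < ε := key.trans_lt (hM.trans_lt hε)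
  rw [CLFormula.eval_inf] at hlt
  obtain ⟨a, ha⟩ := exists_lt_of_ciInf_lt hlt
  refine ⟨a.1, a.2, ?_⟩
  rw [← CLFormula.eval_maxList_le_iff M l _ hε.le]
  -- The bound on `a` was obtained inside `N`; a second use of elementarity, now without the
  -- infimum, gives it in `M`.
  have e := hN (.maxList l) (Function.update w' (s, n) a)
  have e' : (fun p => (Function.update w' (s, n) a p).1) =
      Function.update w (s, n) a.1 := by
    funext p
    by_cases hp : p = (s, n)
    · subst hp
      simp
    · exact (congrArg Subtype.val (Function.update_of_ne hp a w')).trans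
        (Function.update_of_ne hp a.1 w).symm
  change _ = CLFormula.eval M _ (fun p =>
    (Function.update w' (s, n) a p).1) at e
  rw [e'] at e
  rw [← e]
  exact ha.le

/-- A valuation in a substructure with prescribed values on the variables of one sort. -/
lemma CLSubstr.exists_val {M : MStr.{u} L} (N : CLSubstr M) (s : L.Srt) (f : ℕ → M.carrier s)
    (hf : ∀ i, f i ∈ N.carrier s) :
    ∃ w : M.Val, (∀ p, w p ∈ N.carrier p.1) ∧ ∀ i, w (s, i) = f i := by
  classical
  choose d hd using N.nonempty
  let W : ∀ s, ℕ → M.carrier s := Function.update (fun s _ => d s) s f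
  refine ⟨fun p => W p.1 p.2, fun p => ?_, fun i => by simp [W]⟩
  by_cases hp : p.1 = s
  · obtain ⟨t, i⟩ := p
    obtain rfl : t = s := hp
    simpa [W] using hf i
  · simpa [W, Function.update_of_ne hp] using hd p.1

lemma MStr.Iso.eval_term {M N : MStr.{u} L} (e : MStr.Iso M N) (v : M.Val) {s : L.Srt}
    (t : CLTerm L s) :
    e.toEquiv s (t.eval M v) = t.eval N (fun p => e.toEquiv p.1 (v p)) := by
  induction t with
  | var s n => rfl
  | app f args ih =>
    refine (e.map_fn f _).trans ?_
    exact congrArg (N.fn f) (funext ih)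

/-- Isomorphisms preserve the values of formulas. -/
lemma MStr.Iso.eval_formula {M N : MStr.{u} L} (e : MStr.Iso M N) (φ : CLFormula L) :
    ∀ v : M.Val, φ.eval M v = φ.eval N (fun p => e.toEquiv p.1 (v p)) := by
  classical
  have upd : ∀ (v : M.Val) (s : L.Srt) (n : ℕ) (a : M.carrier s),
      (fun p => e.toEquiv p.1 (Function.update v (s, n) a p)) =
        Function.update (fun p => e.toEquiv p.1 (v p)) (s, n) (e.toEquiv s a) := by
    intro v s n a
    funext p
    by_cases hp : p = (s, n)
    · subst hp
      simp
    · simp [Function.update_of_ne hp]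
  induction φ with
  | zero => intro v; rfl
  | one => intro v; rfl
  | dist s t₁ t₂ =>
    intro v
    simp only [CLFormula.eval]
    rw [← e.eval_term, ← e.eval_term, e.dist_eq]
  | rel r args =>
    intro v
    simp only [CLFormula.eval]
    rw [e.map_rel]
    exact congrArg (N.rel r) (funext fun i => e.eval_term v (args i))
  | half φ ih => intro v; simp only [CLFormula.eval, ih]
  | monus φ ψ ih₁ ih₂ => intro v; simp only [CLFormula.eval, ih₁, ih₂]
  | min φ ψ ih₁ ih₂ => intro v; simp only [CLFormula.eval, ih₁, ih₂]
  | max φ ψ ih₁ ih₂ => intro v; simp only [CLFormula.eval, ih₁, ih₂]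
  | absDiff φ ψ ih₁ ih₂ => intro v; simp only [CLFormula.eval, ih₁, ih₂]
  | neg φ ih => intro v; simp only [CLFormula.eval, ih]
  | add φ ψ ih₁ ih₂ => intro v; simp only [CLFormula.eval, ih₁, ih₂]
  | sup s n φ ih =>
    intro v
    rw [CLFormula.eval_sup, CLFormula.eval_sup]
    refine (e.toEquiv s).iSup_congr fun a => ?_
    rw [ih, upd]
  | inf s n φ ih =>
    intro v
    rw [CLFormula.eval_inf, CLFormula.eval_inf]
    refine (e.toEquiv s).iInf_congr fun a => ?_
    rw [ih, upd]

end Logic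

/-! ## Reducts of `A(G, H)` -/

section Reduct

/-- Terms of the language of metric groups as terms of the language of representations. -/
noncomputable def grpTermToGH : {s : grpSig.Srt} → CLTerm grpSig s → CLTerm ghSig (.inl s)
  | _, .var s n => .var (L := ghSig) (.inl s) n
  | _, .app f args => .app (L := ghSig) (.inl (.inl f)) (fun i => grpTermToGH (args i))

/-- Formulas of the language of metric groups as formulas of the language of representations. -/
noncomputable def grpFormulaToGH : CLFormula grpSig → CLFormula ghSig
  | .zero => .zero
  | .one => .one
  | .dist s t₁ t₂ => .dist (.inl s) (grpTermToGH t₁) (grpTermToGH t₂)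
  | .rel r _ => r.elim
  | .half φ => .half (grpFormulaToGH φ)
  | .monus φ ψ => .monus (grpFormulaToGH φ) (grpFormulaToGH ψ)
  | .min φ ψ => .min (grpFormulaToGH φ) (grpFormulaToGH ψ)
  | .max φ ψ => .max (grpFormulaToGH φ) (grpFormulaToGH ψ)
  | .absDiff φ ψ => .absDiff (grpFormulaToGH φ) (grpFormulaToGH ψ)
  | .neg φ => .neg (grpFormulaToGH φ)
  | .add φ ψ => .add (grpFormulaToGH φ) (grpFormulaToGH ψ)
  | .sup s n φ => .sup (.inl s) n (grpFormulaToGH φ)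
  | .inf s n φ => .inf (.inl s) n (grpFormulaToGH φ)

/-- Terms of the language of Hilbert spaces as terms of the language of representations. -/
noncomputable def hilbTermToGH : {s : hilbSig.Srt} → CLTerm hilbSig s → CLTerm ghSig (.inr s)
  | _, .var s n => .var (L := ghSig) (.inr s) n
  | _, .app f args => .app (L := ghSig) (.inl (.inr f)) (fun i => hilbTermToGH (args i))

/-- Formulas of the language of Hilbert spaces as formulas of the language of representations. -/
noncomputable def hilbFormulaToGH : CLFormula hilbSig → CLFormula ghSig
  | .zero => .zero
  | .one => .one
  | .dist s t₁ t₂ => .dist (.inr s) (hilbTermToGH t₁) (hilbTermToGH t₂)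
  | .rel r args => .rel (L := ghSig) r (fun i => hilbTermToGH (args i))
  | .half φ => .half (hilbFormulaToGH φ)
  | .monus φ ψ => .monus (hilbFormulaToGH φ) (hilbFormulaToGH ψ)
  | .min φ ψ => .min (hilbFormulaToGH φ) (hilbFormulaToGH ψ)
  | .max φ ψ => .max (hilbFormulaToGH φ) (hilbFormulaToGH ψ)
  | .absDiff φ ψ => .absDiff (hilbFormulaToGH φ) (hilbFormulaToGH ψ)
  | .neg φ => .neg (hilbFormulaToGH φ)
  | .add φ ψ => .add (hilbFormulaToGH φ) (hilbFormulaToGH ψ)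
  | .sup s n φ => .sup (.inr s) n (hilbFormulaToGH φ)
  | .inf s n φ => .inf (.inr s) n (hilbFormulaToGH φ)

variable {G H : Type u} [Group G] [MetricSpace G] [IsCLGroup G]
  [NormedAddCommGroup H] [InnerProductSpace ℂ H] [CompleteSpace H] (π : UnitaryRep G H)

/-- The restriction of a valuation to the group sort. -/
def UnitaryRep.grpVal (v : π.toStr.Val) : (grpStr G).Val := fun p => v (.inl p.1, p.2)

/-- The restriction of a valuation to the sorts of the Hilbert space. -/
def UnitaryRep.hilbVal (v : π.toStr.Val) : (hilbStr H).Val := fun p => v (.inr p.1, p.2)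

lemma UnitaryRep.grpVal_update [DecidableEq (ghSig.Srt × ℕ)] [DecidableEq (grpSig.Srt × ℕ)]
    (v : π.toStr.Val) (s : grpSig.Srt) (n : ℕ)
    (a : (grpStr G).carrier s) :
    π.grpVal (Function.update v (.inl s, n) a) = Function.update (π.grpVal v) (s, n) a := by
  funext p
  by_cases hp : p = (s, n)
  · subst hp
    rw [Function.update_self]
    exact Function.update_self (β := fun p : ghSig.Srt × ℕ => π.toStr.carrier p.1)
      (Sum.inl s, n) a v
  · rw [Function.update_of_ne hp]
    refine Function.update_of_ne (β := fun p : ghSig.Srt × ℕ => π.toStr.carrier p.1)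
      (a := (Sum.inl p.1, p.2)) (a' := (Sum.inl s, n)) (fun h => hp ?_) a v
    simpa [Prod.ext_iff] using h

lemma UnitaryRep.hilbVal_update [DecidableEq (ghSig.Srt × ℕ)] [DecidableEq (hilbSig.Srt × ℕ)]
    (v : π.toStr.Val) (s : hilbSig.Srt) (n : ℕ)
    (a : (hilbStr H).carrier s) :
    π.hilbVal (Function.update v (.inr s, n) a) = Function.update (π.hilbVal v) (s, n) a := by
  funext p
  by_cases hp : p = (s, n)
  · subst hp
    rw [Function.update_self]
    exact Function.update_self (β := fun p : ghSig.Srt × ℕ => π.toStr.carrier p.1)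
      (Sum.inr s, n) a v
  · rw [Function.update_of_ne hp]
    refine Function.update_of_ne (β := fun p : ghSig.Srt × ℕ => π.toStr.carrier p.1)
      (a := (Sum.inr p.1, p.2)) (a' := (Sum.inr s, n)) (fun h => hp ?_) a v
    simpa [Prod.ext_iff] using h

lemma UnitaryRep.eval_grpTermToGH (v : π.toStr.Val) {s : grpSig.Srt} (t : CLTerm grpSig s) :
    (grpTermToGH t).eval π.toStr v = t.eval (grpStr G) (π.grpVal v) := by
  induction t with
  | var s n => rfl
  | app f args ih => exact congrArg ((grpStr G).fn f) (funext ih)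

lemma UnitaryRep.eval_hilbTermToGH (v : π.toStr.Val) {s : hilbSig.Srt} (t : CLTerm hilbSig s) :
    (hilbTermToGH t).eval π.toStr v = t.eval (hilbStr H) (π.hilbVal v) := by
  induction t with
  | var s n => rfl
  | app f args ih => exact congrArg ((hilbStr H).fn f) (funext ih)

lemma UnitaryRep.eval_grpFormulaToGH (φ : CLFormula grpSig) : ∀ v : π.toStr.Val,
    (grpFormulaToGH φ).eval π.toStr v = φ.eval (grpStr G) (π.grpVal v) := by
  induction φ with
  | zero => intro v; rfl
  | one => intro v; rfl
  | dist s t₁ t₂ =>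
    intro v
    exact congrArg₂ (fun a b : (grpStr G).carrier s => Dist.dist a b)
      (π.eval_grpTermToGH v t₁) (π.eval_grpTermToGH v t₂)
  | rel r args => exact r.elim
  | half φ ih => intro v; simp only [grpFormulaToGH, CLFormula.eval, ih]
  | monus φ ψ ih₁ ih₂ => intro v; simp only [grpFormulaToGH, CLFormula.eval, ih₁, ih₂]
  | min φ ψ ih₁ ih₂ => intro v; simp only [grpFormulaToGH, CLFormula.eval, ih₁, ih₂]
  | max φ ψ ih₁ ih₂ => intro v; simp only [grpFormulaToGH, CLFormula.eval, ih₁, ih₂]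
  | absDiff φ ψ ih₁ ih₂ => intro v; simp only [grpFormulaToGH, CLFormula.eval, ih₁, ih₂]
  | neg φ ih => intro v; simp only [grpFormulaToGH, CLFormula.eval, ih]
  | add φ ψ ih₁ ih₂ => intro v; simp only [grpFormulaToGH, CLFormula.eval, ih₁, ih₂]
  | sup s n φ ih =>
    intro v
    rw [grpFormulaToGH, CLFormula.eval_sup, CLFormula.eval_sup]
    exact iSup_congr fun a => (ih _).trans (congrArg _ (π.grpVal_update v s n a))
  | inf s n φ ih =>
    intro v
    rw [grpFormulaToGH, CLFormula.eval_inf, CLFormula.eval_inf]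
    exact iInf_congr fun a => (ih _).trans (congrArg _ (π.grpVal_update v s n a))

lemma UnitaryRep.eval_hilbFormulaToGH (φ : CLFormula hilbSig) : ∀ v : π.toStr.Val,
    (hilbFormulaToGH φ).eval π.toStr v = φ.eval (hilbStr H) (π.hilbVal v) := by
  induction φ with
  | zero => intro v; rfl
  | one => intro v; rfl
  | dist s t₁ t₂ =>
    intro v
    exact congrArg₂ (fun a b : (hilbStr H).carrier s => Dist.dist a b)
      (π.eval_hilbTermToGH v t₁) (π.eval_hilbTermToGH v t₂)
  | rel r args =>
    intro v
    exact congrArg ((hilbStr H).rel r) (funext fun i => π.eval_hilbTermToGH v (args i))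
  | half φ ih => intro v; simp only [hilbFormulaToGH, CLFormula.eval, ih]
  | monus φ ψ ih₁ ih₂ => intro v; simp only [hilbFormulaToGH, CLFormula.eval, ih₁, ih₂]
  | min φ ψ ih₁ ih₂ => intro v; simp only [hilbFormulaToGH, CLFormula.eval, ih₁, ih₂]
  | max φ ψ ih₁ ih₂ => intro v; simp only [hilbFormulaToGH, CLFormula.eval, ih₁, ih₂]
  | absDiff φ ψ ih₁ ih₂ => intro v; simp only [hilbFormulaToGH, CLFormula.eval, ih₁, ih₂]
  | neg φ ih => intro v; simp only [hilbFormulaToGH, CLFormula.eval, ih]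
  | add φ ψ ih₁ ih₂ => intro v; simp only [hilbFormulaToGH, CLFormula.eval, ih₁, ih₂]
  | sup s n φ ih =>
    intro v
    rw [hilbFormulaToGH, CLFormula.eval_sup, CLFormula.eval_sup]
    exact iSup_congr fun a => (ih _).trans (congrArg _ (π.hilbVal_update v s n a))
  | inf s n φ ih =>
    intro v
    rw [hilbFormulaToGH, CLFormula.eval_inf, CLFormula.eval_inf]
    exact iInf_congr fun a => (ih _).trans (congrArg _ (π.hilbVal_update v s n a))

end Reduct

/-! ## Reformulation of the defining conditions -/

section Conditions

variable (M : MStr.{u} ghSig)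

lemma GH.nrm_nonneg (n : ℕ) (v : GH.Ball M n) : 0 ≤ GH.nrm M n v := Real.sqrt_nonneg _

lemma GH.nrm_le (n : ℕ) (v : GH.Ball M n) : GH.nrm M n v ≤ n := by
  refine Real.sqrt_le_iff.2 ⟨Nat.cast_nonneg _, ?_⟩
  exact (M.rel_mem (.re n) (tuple₂ (α := fun _ => GH.Ball M n) v v)).2

/-- The displacement `‖x ∘ v - v‖`. -/
noncomputable def GH.displ (m : ℕ) (x : GH.Grp M) (v : GH.Ball M m) : ℝ :=
  GH.nrm M (2 * m) (GH.sub M m (GH.act M m x v) v)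

lemma GH.displ_nonneg (m : ℕ) (x : GH.Grp M) (v : GH.Ball M m) : 0 ≤ GH.displ M m x v :=
  GH.nrm_nonneg _ _ _

lemma GH.displ_le (m : ℕ) (x : GH.Grp M) (v : GH.Ball M m) :
    GH.displ M m x v ≤ (2 * m : ℕ) := GH.nrm_le _ _ _

lemma GH.abs_one_sub_nrm_le (m : ℕ) (v : GH.Ball M m) : |1 - GH.nrm M m v| ≤ 1 + m := by
  have h0 := GH.nrm_nonneg M m v
  have h1 := GH.nrm_le M m v
  rw [abs_le]
  constructor <;> linarith

/-- The almost invariance condition of `K_δ(F)` in terms of `ε`. -/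
lemma almost_invariant_iff {δ : ℚ} (hδ : 0 < δ) :
    (∀ k m n : ℕ, 1 ≤ k → 1 ≤ m → 1 ≤ n →
      (⨆ x : Fin k → GH.Grp M, ⨅ v : GH.Ball M m, ⨆ y : (⋃ i, GH.translate M δ (x i) : Set _),
        max (max (GH.nrm M (2 * m) (GH.sub M m (GH.act M m y v) v) - 1 / (n : ℝ)) 0)
          |1 - GH.nrm M m v|) = 0) ↔
    ∀ k m : ℕ, 1 ≤ k → 1 ≤ m → ∀ x : Fin k → GH.Grp M, ∀ ε > 0, ∃ v : GH.Ball M m,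
      (∀ y ∈ ⋃ i, GH.translate M δ (x i), GH.displ M m y v ≤ ε) ∧ |1 - GH.nrm M m v| ≤ ε := by
  -- A real supremum over the empty set is `0` and would hide the condition on `‖v‖`. The point `x₀
  -- · 1` excludes this case.
  have hne : ∀ k : ℕ, 1 ≤ k → ∀ x : Fin k → GH.Grp M,
      Nonempty (⋃ i, GH.translate M δ (x i) : Set _) := by
    intro k hk x
    refine ⟨⟨GH.mul M (x ⟨0, hk⟩) (GH.one M), Set.mem_iUnion.2 ⟨⟨0, hk⟩, GH.one M, ?_, rfl⟩⟩⟩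
    rw [dist_self]
    exact_mod_cast hδ.le
  have hval : ∀ (m n : ℕ) (y : GH.Grp M) (v : GH.Ball M m),
      max (max (GH.nrm M (2 * m) (GH.sub M m (GH.act M m y v) v) - 1 / (n : ℝ)) 0)
        |1 - GH.nrm M m v| ≤ (2 * m : ℕ) + (1 + m) := by
    intro m n y v
    have h0 := GH.displ_le M m y v
    have h1 := GH.abs_one_sub_nrm_le M m v
    have h2 : (0 : ℝ) ≤ 1 / (n : ℝ) := by positivity
    have h3 : (0 : ℝ) ≤ (2 * m : ℕ) := Nat.cast_nonneg _
    have h4 : (0 : ℝ) ≤ m := Nat.cast_nonneg _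
    unfold GH.displ at h0
    refine max_le (max_le ?_ ?_) ?_ <;> linarith
  have hbd : ∀ (m n : ℕ) (S : Set (GH.Grp M)) (v : GH.Ball M m),
      BddAbove (Set.range fun y : S =>
        max (max (GH.nrm M (2 * m) (GH.sub M m (GH.act M m y v) v) - 1 / (n : ℝ)) 0)
          |1 - GH.nrm M m v|) := by
    intro m n S v
    refine ⟨(2 * m : ℕ) + (1 + m), ?_⟩
    rintro _ ⟨y, rfl⟩
    exact hval m n y v
  have hsup0 : ∀ (m n : ℕ) (S : Set (GH.Grp M)) (v : GH.Ball M m), 0 ≤ ⨆ y : S,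
      max (max (GH.nrm M (2 * m) (GH.sub M m (GH.act M m y v) v) - 1 / (n : ℝ)) 0)
          |1 - GH.nrm M m v| :=
    fun m n S v => Real.iSup_nonneg fun y => (abs_nonneg _).trans (le_max_right _ _)
  have hbelow : ∀ (m n : ℕ) (S : Set (GH.Grp M)), BddBelow (Set.range fun v : GH.Ball M m =>
      ⨆ y : S, max (max (GH.nrm M (2 * m) (GH.sub M m (GH.act M m y v) v) - 1 / (n : ℝ)) 0)
          |1 - GH.nrm M m v|) := by
    intro m n S
    refine ⟨0, ?_⟩
    rintro _ ⟨v, rfl⟩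
    exact hsup0 m n S v
  constructor
  · intro h k m hk hm x ε hε
    have := hne k hk x
    -- The displacement will be at most `1/(n+1)`, lost to the truncation, plus `ε/2` from the
    -- infimum.
    obtain ⟨n, hn⟩ := exists_nat_one_div_lt (half_pos hε)
    have h0 := h k m (n + 1) hk hm (by omega)
    have hx : (⨅ v : GH.Ball M m, ⨆ y : (⋃ i, GH.translate M δ (x i) : Set _),
        max (max (GH.nrm M (2 * m) (GH.sub M m (GH.act M m y v) v) - 1 / ((n + 1 : ℕ) : ℝ)) 0)
          |1 - GH.nrm M m v|) ≤ 0 := by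
      refine le_trans ?_ h0.le
      refine le_ciSup (f := fun x : Fin k → GH.Grp M => ⨅ v : GH.Ball M m,
        ⨆ y : (⋃ i, GH.translate M δ (x i) : Set _),
        max (max (GH.nrm M (2 * m) (GH.sub M m (GH.act M m y v) v) - 1 / ((n + 1 : ℕ) : ℝ)) 0)
          |1 - GH.nrm M m v|) ⟨(2 * m : ℕ) + (1 + m), ?_⟩ x
      rintro _ ⟨x', rfl⟩
      have := hne k hk x'
      obtain ⟨v⟩ := M.nonempty (.inr m)
      exact ciInf_le_of_le (hbelow m _ _) v (ciSup_le fun y => hval m _ y v)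
    obtain ⟨v, hv⟩ := exists_lt_of_ciInf_lt (hx.trans_lt (half_pos hε))
    have hy := fun y => (le_ciSup (hbd m (n + 1) _ v) y).trans hv.le
    refine ⟨v, fun y hyS => ?_, ?_⟩
    · have h1 := ((le_max_left _ _).trans (le_max_left _ _)).trans (hy ⟨y, hyS⟩)
      push_cast at h1
      change GH.displ M m y v - 1 / ((n : ℝ) + 1) ≤ ε / 2 at h1
      linarith
    · obtain ⟨y⟩ := this
      exact ((le_max_right _ _).trans (hy y)).trans (half_le_self hε.le)
  · intro h k m n hk hm hn
    have hn' : (0 : ℝ) < 1 / (n : ℝ) := by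
      have : (0 : ℝ) < n := by exact_mod_cast hn
      positivity
    have hz : ∀ x : Fin k → GH.Grp M,
        (⨅ v : GH.Ball M m, ⨆ y : (⋃ i, GH.translate M δ (x i) : Set _),
        max (max (GH.nrm M (2 * m) (GH.sub M m (GH.act M m y v) v) - 1 / (n : ℝ)) 0)
          |1 - GH.nrm M m v|) = 0 := by
      intro x
      have := hne k hk x
      refine le_antisymm (le_of_forall_pos_le_add fun ε hε => ?_)
        (Real.iInf_nonneg fun v => hsup0 m n _ v)
      -- The bound `1/n` makes the truncated displacement vanish; the bound `ε` serves the norm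
      -- term.
      obtain ⟨v, hv, hv'⟩ := h k m hk hm x (min ε (1 / n)) (lt_min hε hn')
      rw [zero_add]
      refine ciInf_le_of_le (hbelow m n _) v (ciSup_le fun y => ?_)
      have h1 := (hv y y.2).trans (min_le_right _ _)
      unfold GH.displ at h1
      exact max_le (max_le (by linarith) hε.le) (hv'.trans (min_le_left _ _))
    simp_rw [hz]
    exact Real.iSup_const_zero

/-- The condition `NIV` in terms of `ε`. -/
lemma NIV_iff : NIV M ↔ ∀ v : GH.Ball M 1, ∀ ε > 0, ∃ x : GH.Grp M,
    1 - (GH.displ M 1 x v + |1 - GH.nrm M 1 v|) ≤ ε := by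
  have hbelow : ∀ v : GH.Ball M 1, BddBelow (Set.range fun x : GH.Grp M =>
      max (1 - (GH.displ M 1 x v + |1 - GH.nrm M 1 v|)) 0) := by
    intro v
    refine ⟨0, ?_⟩
    rintro _ ⟨x, rfl⟩
    exact le_max_right _ _
  have habove : BddAbove (Set.range fun v : GH.Ball M 1 => ⨅ x : GH.Grp M,
      max (1 - (GH.displ M 1 x v + |1 - GH.nrm M 1 v|)) 0) := by
    refine ⟨1, ?_⟩
    rintro _ ⟨v, rfl⟩
    refine ciInf_le_of_le (hbelow v) (GH.one M) (max_le ?_ zero_le_one)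
    have h1 := GH.displ_nonneg M 1 (GH.one M) v
    have h2 := abs_nonneg (1 - GH.nrm M 1 v)
    linarith
  constructor
  · intro h v ε hε
    have hv := ((le_ciSup habove v).trans h).trans_lt hε
    obtain ⟨x, hx⟩ := exists_lt_of_ciInf_lt hv
    exact ⟨x, (le_max_left _ _).trans hx.le⟩
  · intro h
    refine ciSup_le fun v => le_of_forall_pos_le_add fun ε hε => ?_
    obtain ⟨x, hx⟩ := h v ε hε
    rw [zero_add]
    exact ciInf_le_of_le (hbelow v) x (max_le hx hε.le)

end Conditions

/-! ### Norm and displacement in `A(G, H)` and in substructures -/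

section Concrete

variable {G H : Type u} [Group G] [MetricSpace G] [IsCLGroup G]
  [NormedAddCommGroup H] [InnerProductSpace ℂ H] [CompleteSpace H] {π : UnitaryRep G H}

lemma UnitaryRep.nrm_toStr (n : ℕ) (v : HBall H n) : GH.nrm π.toStr n v = ‖v.1‖ := by
  change Real.sqrt (inner ℂ v.1 v.1).re = ‖v.1‖
  rw [norm_eq_sqrt_re_inner (𝕜 := ℂ)]
  rfl

lemma UnitaryRep.displ_toStr (m : ℕ) (g : G) (v : HBall H m) :
    GH.displ π.toStr m g v = ‖π.toHom g v.1 - v.1‖ :=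
  UnitaryRep.nrm_toStr (2 * m) _

end Concrete

section Substr

variable {M : MStr.{u} ghSig} (N : CLSubstr M)

/-- Operations of a substructure coerce their arguments coordinatewise; moving the coercion onto the
two entries turns its binary operations into those of `M`. -/
lemma tuple₂_val {α : Fin 2 → Type u} {S : ∀ i, Set (α i)} (a : S 0) (b : S 1) :
    (fun i => (tuple₂ (α := fun i => S i) a b i).1) = tuple₂ a.1 b.1 := by
  funext i
  fin_cases i <;> rfl

lemma CLSubstr.nrm_toStr (n : ℕ) (v : GH.Ball N.toStr n) :
    GH.nrm N.toStr n v = GH.nrm M n v.1 :=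
  congrArg (fun t => Real.sqrt (M.rel (.re n) t)) (tuple₂_val
    (S := fun _ => N.carrier (.inr n)) v v)

lemma CLSubstr.act_toStr (m : ℕ) (x : GH.Grp N.toStr) (v : GH.Ball N.toStr m) :
    (GH.act N.toStr m x v).1 = GH.act M m x.1 v.1 :=
  congrArg (M.fn (.inr m)) (tuple₂_val
    (S := fun i => N.carrier (ghSig.dom (.inr m) i)) x v)

lemma CLSubstr.mul_toStr (x y : GH.Grp N.toStr) :
    (GH.mul N.toStr x y).1 = GH.mul M x.1 y.1 :=
  congrArg (M.fn (.inl (.inl .mul))) (tuple₂_val (S := fun _ => N.carrier (.inl ())) x y)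

lemma CLSubstr.one_toStr : (GH.one N.toStr).1 = GH.one M :=
  congrArg (M.fn (.inl (.inl .one))) (funext fun i : Fin 0 => i.elim0)

lemma CLSubstr.displ_toStr (m : ℕ) (x : GH.Grp N.toStr) (v : GH.Ball N.toStr m) :
    GH.displ N.toStr m x v = GH.displ M m x.1 v.1 := by
  unfold GH.displ
  rw [CLSubstr.nrm_toStr]
  congr 1
  refine (congrArg (M.fn (.inl (.inr (.sub m)))) (tuple₂_val
    (S := fun _ => N.carrier (.inr m)) (GH.act N.toStr m x v) v)).trans ?_
  rw [CLSubstr.act_toStr]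
  rfl

end Substr

/-! ## The group and the Hilbert space of a substructure -/

/-! ### Formulas for displacement, norm and membership in a smaller ball -/

section Formulas

/-- The formula `d(x ∘ v, v)`. -/
noncomputable def displFormula (m j : ℕ) : CLFormula ghSig :=
  .dist (.inr m)
    (.app (L := ghSig) (.inr m) (tuple₂ (α := fun i => CLTerm ghSig (ghSig.dom (.inr m) i))
      (.var (L := ghSig) (.inl ()) j) (.var (L := ghSig) (.inr m) 0)))
    (.var (L := ghSig) (.inr m) 0)

/-- The formula `|1 - d(v, 0)|`. -/
noncomputable def nrmFormula (m : ℕ) (hm : 0 < m) : CLFormula ghSig :=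
  .absDiff .one (.dist (.inr m) (.var (L := ghSig) (.inr m) 0)
    (.app (L := ghSig) (.inl (.inr (.incl 0 m hm))) fun _ =>
      .app (L := ghSig) (.inl (.inr .zero)) fun i : Fin 0 => i.elim0))

/-- The formula `d(I w, v)`. -/
noncomputable def inclFormula (n m : ℕ) (h : n < m) : CLFormula ghSig :=
  .dist (.inr m)
    (.app (L := ghSig) (.inl (.inr (.incl n m h))) fun _ => .var (L := ghSig) (.inr n) 0)
    (.var (L := ghSig) (.inr m) 0)

variable {G H : Type u} [Group G] [MetricSpace G] [IsCLGroup G]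
  [NormedAddCommGroup H] [InnerProductSpace ℂ H] [CompleteSpace H] {π : UnitaryRep G H}

lemma eval_displFormula (m j : ℕ) (u : π.toStr.Val) (g : G) (v : HBall H m)
    (hg : u (.inl (), j) = g) (hv : u (.inr m, 0) = v) :
    (displFormula m j).eval π.toStr u = ‖π.toHom g v.1 - v.1‖ := by
  subst hg hv
  rw [← dist_eq_norm]
  rfl

/-- The classes use a norm defined by a square root, which is not a connective; distance to the
constant `0` expresses the same quantity. That constant has sort `B_0` and must be included into
`B_m`, whence `0 < m`. -/
lemma eval_nrmFormula (m : ℕ) (hm : 0 < m) (u : π.toStr.Val) (v : HBall H m)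
    (hv : u (.inr m, 0) = v) :
    (nrmFormula m hm).eval π.toStr u = |1 - ‖v.1‖| := by
  subst hv
  rw [← dist_zero_right]
  rfl

lemma eval_inclFormula (n m : ℕ) (h : n < m) (u : π.toStr.Val) (w : HBall H n) (v : HBall H m)
    (hw : u (.inr n, 0) = w) (hv : u (.inr m, 0) = v) :
    (inclFormula n m h).eval π.toStr u = dist w.1 v.1 := by
  subst hw hv
  rfl

end Formulas

/-! ### Subgroup, subspace and restricted representation -/

section Components

variable {G H : Type u} [Group G] [MetricSpace G] [IsCLGroup G]
  [NormedAddCommGroup H] [InnerProductSpace ℂ H] [CompleteSpace H] {π : UnitaryRep G H}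
  (N : CLSubstr π.toStr)

/-- The part of a substructure of `A(G, H)` in the ball `B_n`. -/
def CLSubstr.ball (n : ℕ) : Set (HBall H n) := N.carrier (.inr n)

/-- The group of a substructure of `A(G, H)`. -/
def CLSubstr.subgroup : Subgroup G where
  carrier := (N.carrier (.inl ()) : Set G)
  mul_mem' {a b} ha hb := N.fn_mem (.inl (.inl .mul)) (tuple₂ (α := fun _ => G) a b) (by
    intro i
    change Fin 2 at i
    fin_cases i
    exacts [ha, hb])
  one_mem' := N.fn_mem (.inl (.inl .one)) (fun i : Fin 0 => i.elim0) fun i : Fin 0 => i.elim0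
  inv_mem' {a} ha := N.fn_mem (.inl (.inl .inv)) (fun _ => a) fun _ => ha

lemma CLSubstr.ball_mono {m n : ℕ} (h : m ≤ n) {v : H} (hm : ‖v‖ ≤ m) (hn : ‖v‖ ≤ n)
    (hv : (⟨v, hm⟩ : HBall H m) ∈ N.ball m) : (⟨v, hn⟩ : HBall H n) ∈ N.ball n := by
  rcases h.eq_or_lt with rfl | h
  · exact hv
  · exact N.fn_mem (.inl (.inr (.incl m n h))) (fun _ => (⟨v, hm⟩ : HBall H m)) fun _ => hv

/-- The linear subspace of a substructure of `A(G, H)`. -/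
def CLSubstr.subspace : Submodule ℂ H where
  carrier := {v | ∃ (n : ℕ) (h : ‖v‖ ≤ n), (⟨v, h⟩ : HBall H n) ∈ N.ball n}
  add_mem' := by
    rintro v w ⟨m, hv, hv'⟩ ⟨n, hw, hw'⟩
    -- Addition is defined only within one ball, so both summands are first moved to `B_{max m n}`.
    have hm : (m : ℝ) ≤ (max m n : ℕ) := Nat.cast_le.2 (le_max_left _ _)
    have hn : (n : ℝ) ≤ (max m n : ℕ) := Nat.cast_le.2 (le_max_right _ _)
    have h1 := N.ball_mono (le_max_left m n) hv (hv.trans hm) hv'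
    have h2 := N.ball_mono (le_max_right m n) hw (hw.trans hn) hw'
    have h := N.fn_mem (.inl (.inr (.add (max m n))))
      (tuple₂ (α := fun _ => HBall H (max m n)) ⟨v, hv.trans hm⟩ ⟨w, hw.trans hn⟩) (by
        intro i
        change Fin 2 at i
        fin_cases i
        exacts [h1, h2])
    exact ⟨_, _, h⟩
  zero_mem' := ⟨0, _, N.fn_mem (.inl (.inr .zero)) (fun i : Fin 0 => i.elim0)
    fun i : Fin 0 => i.elim0⟩
  smul_mem' := by
    rintro c v ⟨m, hv, hv'⟩
    exact ⟨_, _, N.fn_mem (.inl (.inr (.smul c m))) (fun _ => (⟨v, hv⟩ : HBall H m)) fun _ => hv'⟩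

variable {N}

/-- The operations only carry vectors to larger balls, so a short vector present in `B_m` could be
missing from `B_n` in a mere substructure. In `A(G, H)` the condition `d(I w, v) = 0` is solved by
`v` itself; elementarity gives approximate solutions `w` in the ball `B_n` of `N`, and that ball is
closed. -/
lemma CLSubstr.IsElementary.mem_ball (hN : N.IsElementary) {v : H} (hv : v ∈ N.subspace) (n : ℕ)
    (hn : ‖v‖ ≤ n) : (⟨v, hn⟩ : HBall H n) ∈ N.ball n := by
  classical
  obtain ⟨m, hm, hvm⟩ := hv
  rcases le_or_gt m n with h | h
  · exact N.ball_mono h hm hn hvm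
  have hcl : IsClosed (N.ball n) := N.isClosed (.inr n)
  rw [← hcl.closure_eq, Metric.mem_closure_iff]
  intro ε hε
  obtain ⟨w, hw, hwv⟩ := N.exists_val (.inr m) (fun _ => (⟨v, hm⟩ : HBall H m)) fun _ => hvm
  have hne : ((.inr m, 0) : ghSig.Srt × ℕ) ≠ (.inr n, 0) := by
    simpa using h.ne'
  have hval : ∀ a : HBall H n, (inclFormula n m h).eval π.toStr
      (Function.update w (.inr n, 0) a) = dist a.1 v := by
    intro a
    refine eval_inclFormula n m h _ a ⟨v, hm⟩ ?_ ?_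
    · exact Function.update_self _ _ _
    · exact (Function.update_of_ne hne _ _).trans (hwv 0)
  obtain ⟨a, ha, hav⟩ := hN.exists_mem_of_forall_exists w hw [inclFormula n m h] (.inr n) 0
    (fun η hη => ⟨(⟨v, hn⟩ : HBall H n), fun φ hφ => by
      rw [List.mem_singleton.1 hφ, hval, dist_self]
      exact hη.le⟩) (ε / 2) (half_pos hε)
  refine ⟨a, ha, ?_⟩
  have := (hval a).symm.trans_le (hav _ (List.mem_singleton.2 rfl))
  exact (dist_comm v _).trans_lt (this.trans_lt (half_lt_self hε))

/-- A convergent sequence is bounded, so by `mem_ball` it lies in a single ball `B_n` of `N`, which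
is closed. -/
lemma CLSubstr.IsElementary.isClosed_subspace (hN : N.IsElementary) :
    IsClosed (N.subspace : Set H) := by
  refine IsSeqClosed.isClosed fun x v hx hxv => ?_
  obtain ⟨C, hC⟩ := (Metric.isBounded_range_of_tendsto x hxv).exists_norm_le
  obtain ⟨n, hn⟩ := exists_nat_ge C
  have hxn : ∀ i, ‖x i‖ ≤ n := fun i => (hC _ ⟨i, rfl⟩).trans hn
  have hvn : ‖v‖ ≤ n := le_of_tendsto hxv.norm (Filter.Eventually.of_forall hxn)
  have hcl : IsClosed (N.ball n) := N.isClosed (.inr n)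
  refine ⟨n, hvn, hcl.mem_of_tendsto (f := fun i => (⟨x i, hxn i⟩ : HBall H n))
    (b := Filter.atTop) ?_ (Filter.Eventually.of_forall fun i => hN.mem_ball (hx i) n (hxn i))⟩
  exact tendsto_subtype_rng.2 hxv

lemma CLSubstr.map_mem_subspace {g : G} (hg : g ∈ N.subgroup) {v : H} (hv : v ∈ N.subspace) :
    π.toHom g v ∈ N.subspace := by
  obtain ⟨m, hm, hv⟩ := hv
  have h := N.fn_mem (.inr m) (tuple₂ (α := fun i => π.toStr.carrier (ghSig.dom (.inr m) i)) g
    (⟨v, hm⟩ : HBall H m)) (by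
      intro i
      change Fin 2 at i
      fin_cases i
      exacts [hg, hv])
  exact ⟨_, _, h⟩

lemma CLSubstr.isClosed_subgroup : IsClosed (N.subgroup : Set G) := N.isClosed (.inl ())

lemma CLSubstr.isCLGroup_subgroup : IsCLGroup N.subgroup where
  dist_mul_left a x y := IsCLGroup.dist_mul_left (a : G) x y
  dist_mul_right a x y := IsCLGroup.dist_mul_right (a : G) x y
  dist_le_one x y := IsCLGroup.dist_le_one (x : G) y
  complete := by
    have : CompleteSpace G := IsCLGroup.complete
    exact N.isClosed_subgroup.completeSpace_coe

variable (N)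

/-- The restricted representation. -/
def CLSubstr.rep : UnitaryRep N.subgroup N.subspace where
  toHom :=
    { toFun := fun g =>
        { toFun := fun v => ⟨π.toHom g v, N.map_mem_subspace g.2 v.2⟩
          invFun := fun v => ⟨π.toHom (g⁻¹ : N.subgroup) v, N.map_mem_subspace (g⁻¹).2 v.2⟩
          left_inv := fun v => Subtype.ext (by
            change (π.toHom ((g : G)⁻¹) * π.toHom (g : G)) (v : H) = v
            rw [← map_mul, inv_mul_cancel, map_one]
            rfl)
          right_inv := fun v => Subtype.ext (by
            change (π.toHom (g : G) * π.toHom ((g : G)⁻¹)) (v : H) = v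
            rw [← map_mul, mul_inv_cancel, map_one]
            rfl)
          map_add' := fun v w => Subtype.ext (map_add (π.toHom (g : G)) (v : H) w)
          map_smul' := fun c v => Subtype.ext (map_smul (π.toHom (g : G)) c (v : H))
          norm_map' := fun v => (π.toHom (g : G)).norm_map (v : H) }
      map_one' := by
        ext v
        change π.toHom (1 : G) v = v
        rw [map_one]
        rfl
      map_mul' := fun g h => by
        ext v
        change π.toHom ((g : G) * h) v = π.toHom g (π.toHom h v)
        rw [map_mul]
        rfl }
  uc ε hε := by
    obtain ⟨η, hη, h⟩ := π.uc ε hε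
    exact ⟨η, hη, fun g g' hg v hv => h g g' hg v hv⟩

variable {N}

/-- The sorts of an elementary substructure are those of the restricted representation. -/
def CLSubstr.IsElementary.sortEquiv [IsCLGroup N.subgroup] [CompleteSpace N.subspace]
    (hN : N.IsElementary) : ∀ s : ghSig.Srt, N.rep.toStr.carrier s ≃ N.toStr.carrier s
  | .inl () => Equiv.refl N.subgroup
  | .inr n =>
    { toFun := fun v : HBall N.subspace n =>
        (⟨(⟨(v.1 : H), v.2⟩ : HBall H n), hN.mem_ball v.1.2 n v.2⟩ : N.ball n)
      invFun := fun v : N.ball n => (⟨⟨v.1.1, n, v.1.2, v.2⟩, v.1.2⟩ : HBall N.subspace n)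
      left_inv := fun _ => rfl
      right_inv := fun _ => rfl }

/-- An elementary substructure is the structure of the restricted representation. -/
def CLSubstr.IsElementary.iso [IsCLGroup N.subgroup] [CompleteSpace N.subspace]
    (hN : N.IsElementary) : MStr.Iso N.rep.toStr N.toStr where
  toEquiv := hN.sortEquiv
  dist_eq
    | .inl () => fun _ _ => rfl
    | .inr _ => fun _ _ => rfl
  map_fn
    | .inl (.inl .mul) => fun _ => rfl
    | .inl (.inl .inv) => fun _ => rfl
    | .inl (.inl .one) => fun _ => rfl
    | .inl (.inr .zero) => fun _ => rfl
    | .inl (.inr (.incl _ _ _)) => fun _ => rfl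
    | .inl (.inr (.smul _ _)) => fun _ => rfl
    | .inl (.inr (.add _)) => fun _ => rfl
    | .inl (.inr (.sub _)) => fun _ => rfl
    | .inr _ => fun _ => rfl
  map_rel
    | .re _ => fun _ => rfl
    | .im _ => fun _ => rfl

/-- The inverse of an isomorphism. -/
def MStr.Iso.symm {L : CLSig} {M M' : MStr.{u} L} (e : MStr.Iso M M') : MStr.Iso M' M where
  toEquiv s := (e.toEquiv s).symm
  dist_eq s x y := by rw [← e.dist_eq]; simp
  map_fn f x := by
    rw [Equiv.symm_apply_eq, e.map_fn]
    simp
  map_rel r x := by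
    rw [e.map_rel]
    simp

/-- The value of a translated formula is followed from `G₀` to the restricted representation, then
to `N`, to `A(G, H)` and to `G`. Variables of the other sorts do not occur, so their values are
arbitrary. -/
lemma CLSubstr.IsElementary.grp_elementary [IsCLGroup N.subgroup] [CompleteSpace N.subspace]
    (hN : N.IsElementary) :
    IsElementaryEmb (grpStr N.subgroup) (grpStr G) (grpIncl N.subgroup) := by
  intro φ v
  let w : N.rep.toStr.Val := fun p => match p with
    | (.inl (), n) => v ((), n)
    | (.inr m, _) => ((hilbStr N.subspace).nonempty m).some
  have h1 := N.rep.eval_grpFormulaToGH φ w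
  have h2 := hN.iso.eval_formula (grpFormulaToGH φ) w
  have h3 := hN (grpFormulaToGH φ) (fun p => hN.iso.toEquiv p.1 (w p))
  have h4 := π.eval_grpFormulaToGH φ (fun p => (hN.iso.toEquiv p.1 (w p)).1)
  exact h1.symm.trans (h2.trans (h3.trans h4))

lemma CLSubstr.IsElementary.hilb_elementary [IsCLGroup N.subgroup] [CompleteSpace N.subspace]
    (hN : N.IsElementary) :
    IsElementaryEmb (hilbStr N.subspace) (hilbStr H) (hilbIncl N.subspace) := by
  intro φ v
  let w : N.rep.toStr.Val := fun p => match p with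
    | (.inl (), _) => (1 : N.subgroup)
    | (.inr m, n) => v (m, n)
  have h1 := N.rep.eval_hilbFormulaToGH φ w
  have h2 := hN.iso.eval_formula (hilbFormulaToGH φ) w
  have h3 := hN (hilbFormulaToGH φ) (fun p => hN.iso.toEquiv p.1 (w p))
  have h4 := π.eval_hilbFormulaToGH φ (fun p => (hN.iso.toEquiv p.1 (w p)).1)
  exact h1.symm.trans (h2.trans (h3.trans h4))

end Components

/-! ## Transfer of the defining conditions to elementary substructures -/

/-- A finite subset of `S` is listed by a sequence in `S`. -/
lemma Set.Finite.exists_seq {α : Type*} {P S : Set α} (hP : P.Finite) (hPS : P ⊆ S)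
    (hS : S.Nonempty) : ∃ (f : ℕ → α) (n : ℕ), (∀ i, f i ∈ S) ∧ ∀ a ∈ P, ∃ i < n, f i = a := by
  classical
  obtain ⟨d, hd⟩ := hS
  let l := hP.toFinset.toList
  refine ⟨fun i => l.getD i d, l.length, fun i => ?_, fun a ha => ?_⟩
  · rcases lt_or_ge i l.length with hi | hi
    · have : l[i] ∈ l := List.getElem_mem hi
      simp only [List.getD_eq_getElem _ _ hi]
      exact hPS (hP.mem_toFinset.1 (Finset.mem_toList.1 this))
    · simpa only [List.getD_eq_default _ _ hi] using hd
  · have : a ∈ l := by simpa [l] using ha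
    obtain ⟨i, hi, rfl⟩ := List.mem_iff_getElem.1 this
    exact ⟨i, hi, List.getD_eq_getElem _ _ hi⟩

section Transfer

variable {G H : Type u} [Group G] [MetricSpace G] [IsCLGroup G]
  [NormedAddCommGroup H] [InnerProductSpace ℂ H] [CompleteSpace H] {π : UnitaryRep G H}
  {N : CLSubstr π.toStr}

/-- Finite-dimensionality depends only on the structure. -/
lemma UnitaryRep.finiteDimensional_of_iso {G' H' : Type u} [Group G'] [MetricSpace G']
    [IsCLGroup G'] [NormedAddCommGroup H'] [InnerProductSpace ℂ H'] [CompleteSpace H']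
    {π' : UnitaryRep G' H'} (e : MStr.Iso π.toStr π'.toStr) [FiniteDimensional ℂ H] :
    FiniteDimensional ℂ H' := by
  have hball : ∀ (E : Type u) [NormedAddCommGroup E],
      {v : E | ‖v‖ ≤ (1 : ℕ)} = Metric.closedBall 0 1 := by
    intro E _
    ext v
    simp
  have : ProperSpace H := FiniteDimensional.proper ℂ H
  -- Compactness of the unit ball is a metric property of the sort `B_1`, so it passes along the
  -- isomorphism; by Riesz's theorem it forces finite dimension.
  have hc : CompactSpace (HBall H 1) := by
    have hK : IsCompact {v : H | ‖v‖ ≤ (1 : ℕ)} := by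
      rw [hball]
      exact isCompact_closedBall _ _
    exact isCompact_iff_compactSpace.1 hK
  let E : HBall H 1 ≃ᵢ HBall H' 1 :=
    ⟨e.toEquiv (.inr 1), Isometry.of_dist_eq (e.dist_eq (.inr 1))⟩
  have hc' : CompactSpace (HBall H' 1) := E.toHomeomorph.compactSpace
  have hK : IsCompact {v : H' | ‖v‖ ≤ (1 : ℕ)} := isCompact_iff_compactSpace.2 hc'
  rw [hball] at hK
  exact FiniteDimensional.of_isCompact_closedBall₀ ℂ one_pos hK

/-- The Hilbert space of an elementary substructure is infinite-dimensional if the whole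
Hilbert space is. -/
lemma CLSubstr.IsElementary.not_finiteDimensional (hN : N.IsElementary)
    (hH : ¬ FiniteDimensional ℂ H) : ¬ FiniteDimensional ℂ N.subspace := by
  classical
  intro hfin
  have hne : N.subspaceᗮ ≠ ⊥ := by
    rw [Ne, Submodule.orthogonal_eq_bot_iff]
    intro h
    exact hH ((LinearEquiv.ofTop _ h).finiteDimensional)
  obtain ⟨b, hb, hb0⟩ := Submodule.exists_mem_ne_zero_of_ne_bot hne
  obtain ⟨e, he, he1⟩ : ∃ e ∈ N.subspaceᗮ, ‖e‖ = 1 :=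
    ⟨((‖b‖ : ℂ)⁻¹) • b, Submodule.smul_mem _ _ hb, norm_smul_inv_norm hb0⟩
  -- Cauchy–Schwarz applied to `⟨e, e - a⟩ = 1`.
  have hdist : ∀ a ∈ N.subspace, 1 ≤ dist e a := by
    intro a ha
    have h1 : (inner ℂ e (e - a)).re = 1 := by
      rw [inner_sub_right, Submodule.inner_left_of_mem_orthogonal ha he,
        inner_self_eq_norm_sq_to_K, he1]
      simp
    have h2 := (Complex.abs_re_le_norm _).trans (norm_inner_le_norm (𝕜 := ℂ) e (e - a))
    rw [h1, he1, abs_one, one_mul] at h2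
    rwa [dist_eq_norm]
  have : ProperSpace N.subspace := FiniteDimensional.proper ℂ N.subspace
  obtain ⟨t, ht, htf, hcov⟩ := (isCompact_closedBall (0 : N.subspace) 1).finite_cover_balls
    (e := 1 / 2) (by norm_num)
  let P : Set (HBall H 1) := Subtype.val ⁻¹' ((fun a : N.subspace => (a : H)) '' t)
  have hP : P.Finite := (htf.image _).preimage Subtype.val_injective.injOn
  have hPN : P ⊆ N.ball 1 := by
    rintro ⟨v, hv⟩ ⟨a, -, rfl⟩
    exact hN.mem_ball a.2 1 hv
  obtain ⟨f, r, hf, hfr⟩ := hP.exists_seq hPN (N.nonempty (.inr 1))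
  -- Variable `0` is reserved for the unknown, so the net point `f j` is the value of variable `j +
  -- 1`.
  obtain ⟨w, hw, hwf⟩ := N.exists_val (.inr 1) (fun i => f (i - 1)) fun i => hf _
  let φ : ℕ → CLFormula ghSig := fun j => .neg (.dist (.inr 1)
    (.var (L := ghSig) (.inr 1) 0) (.var (L := ghSig) (.inr 1) (j + 1)))
  have hval : ∀ (a : HBall H 1) (j : ℕ), (φ j).eval π.toStr
      (Function.update w (.inr 1, 0) a) = 1 - dist a (f j) := by
    intro a j
    have h1 : Function.update w (.inr 1, 0) a (.inr 1, 0) = a := Function.update_self _ _ _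
    have h2 : Function.update w (.inr 1, 0) a (.inr 1, j + 1) = f j :=
      (Function.update_of_ne (by simp) _ _).trans (hwf (j + 1))
    change 1 - dist (Function.update w (.inr 1, 0) a (.inr 1, 0))
      (Function.update w (.inr 1, 0) a (.inr 1, j + 1)) = _
    rw [h1, h2]
    rfl
  -- The vector `e` solves `1 - d(·, f j) ≤ 0` for all `j`. The tolerance `1/4` gives `a` in `N` at
  -- distance at least `3/4` from every net point, against the `1/2`-net.
  obtain ⟨a, ha, hav⟩ := hN.exists_mem_of_forall_exists w hw ((List.range r).map φ) (.inr 1) 0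
    (fun η hη => ⟨(⟨e, by simp [he1]⟩ : HBall H 1), fun ψ hψ => by
      obtain ⟨j, -, rfl⟩ := List.mem_map.1 hψ
      rw [hval]
      have := hdist (f j).1 ⟨1, (f j).2, hf j⟩
      rw [Subtype.dist_eq]
      linarith⟩) (1 / 4) (by norm_num)
  change HBall H 1 at a
  have ha1 : ‖a.1‖ ≤ 1 := by simpa using a.2
  have haH : a.1 ∈ N.subspace := ⟨1, a.2, ha⟩
  obtain ⟨c, hct, hc⟩ := Set.mem_iUnion₂.1 (hcov (show (⟨a.1, haH⟩ : N.subspace) ∈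
    Metric.closedBall 0 1 by simpa using ha1))
  have hc1 : ‖(c : H)‖ ≤ (1 : ℕ) := by simpa using ht hct
  obtain ⟨j, hj, hjc⟩ := hfr ⟨c, hc1⟩ ⟨c, hct, rfl⟩
  have h1 := (hval a j).symm.trans_le
    (hav _ (List.mem_map.2 ⟨j, List.mem_range.2 hj, rfl⟩))
  rw [hjc, Subtype.dist_eq] at h1
  have h2 : dist a.1 (c : H) < 1 / 2 := hc
  change 1 - dist a.1 (c : H) ≤ 1 / 4 at h1
  linarith

/-- For fixed `v` in `N`, the requirement on `x` is a single formula with parameter `v`, so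
approximate witnesses can be moved into `N`; no compactness is needed. -/
lemma CLSubstr.IsElementary.NIV_toStr (hN : N.IsElementary) (h : NIV π.toStr) :
    NIV N.toStr := by
  classical
  rw [NIV_iff] at h ⊢
  intro v ε hε
  obtain ⟨w, hw, hwv⟩ := N.exists_val (.inr 1) (fun _ => v.1) fun _ => v.2
  have hval : ∀ g : G, (CLFormula.neg (.add (displFormula 1 0) (nrmFormula 1 one_pos))).eval
      π.toStr (Function.update w (.inl (), 0) g) =
      1 - (GH.displ π.toStr 1 g v.1 + |1 - GH.nrm π.toStr 1 v.1|) := by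
    intro g
    have hv : Function.update w (.inl (), 0) g (.inr 1, 0) = v.1 :=
      (Function.update_of_ne (by simp) _ _).trans (hwv 0)
    have h1 := eval_displFormula (π := π) 1 0 _ g v.1 (Function.update_self _ _ _) hv
    have h2 := eval_nrmFormula (π := π) 1 one_pos _ v.1 hv
    rw [CLFormula.eval, CLFormula.eval, h1, h2]
    exact congrArg₂ (fun a b => 1 - (a + |1 - b|)) (UnitaryRep.displ_toStr 1 g v.1).symm
      (UnitaryRep.nrm_toStr (π := π) 1 v.1).symm
  obtain ⟨g, hg, hgv⟩ := hN.exists_mem_of_forall_exists w hw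
    [.neg (.add (displFormula 1 0) (nrmFormula 1 one_pos))] (.inl ()) 0
    (fun η hη => by
      obtain ⟨x, hx⟩ := h v.1 η hη
      refine ⟨x, fun ψ hψ => ?_⟩
      rw [List.mem_singleton.1 hψ]
      exact (hval x).trans_le hx) ε hε
  refine ⟨⟨g, hg⟩, ?_⟩
  refine (congrArg₂ (fun a b => 1 - (a + |1 - b|)) (N.displ_toStr 1 ⟨g, hg⟩ v)
    (N.nrm_toStr 1 v)).trans_le ?_
  exact (hval g).symm.trans_le (hgv _ (List.mem_singleton.2 rfl))

lemma CLSubstr.displ_mul_toStr (m : ℕ) (x g : N.subgroup) (v : N.ball m) :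
    GH.displ N.toStr m (GH.mul N.toStr x g) v =
      ‖π.toHom ((x : G) * g) v.1.1 - v.1.1‖ := by
  refine (N.displ_toStr m _ v).trans ?_
  rw [N.mul_toStr x g]
  exact UnitaryRep.displ_toStr m ((x : G) * g) v.1

/-- Almost invariant vectors can be found in the substructure, for translates of a compact
ball around `1`. -/
lemma CLSubstr.IsElementary.exists_almost_invariant (hN : N.IsElementary) {δ δ' : ℚ}
    (hδ' : 0 < δ') (hδδ' : δ' ≤ δ) (hcpt : IsCompact (Metric.closedBall (1 : G) δ'))
    (h : ∀ k m : ℕ, 1 ≤ k → 1 ≤ m → ∀ x : Fin k → GH.Grp π.toStr, ∀ ε > 0,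
      ∃ v : GH.Ball π.toStr m, (∀ y ∈ ⋃ i, GH.translate π.toStr δ (x i),
        GH.displ π.toStr m y v ≤ ε) ∧ |1 - GH.nrm π.toStr m v| ≤ ε) :
    ∀ k m : ℕ, 1 ≤ k → 1 ≤ m → ∀ x : Fin k → GH.Grp N.toStr, ∀ ε > 0,
      ∃ v : GH.Ball N.toStr m, (∀ y ∈ ⋃ i, GH.translate N.toStr δ' (x i),
        GH.displ N.toStr m y v ≤ ε) ∧ |1 - GH.nrm N.toStr m v| ≤ ε := by
  classical
  intro k m hk hm x ε hε
  obtain ⟨η, hη, hηv⟩ := π.uc_ball m (ε / 2) (half_pos hε)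
  let X : Fin k → G := fun i => (x i).1
  have hX : ∀ i, X i ∈ N.subgroup := fun i => (x i).2
  -- Covering the intersection with the subgroup, not the ball itself, puts the centres in `N`, so
  -- that they can serve as parameters.
  obtain ⟨t, ht, htf, hcov⟩ := (hcpt.inter_right N.isClosed_subgroup).finite_cover_balls hη
  let P : Set G := Set.image2 (fun i g => X i * g) Set.univ t
  have hP : P.Finite := Set.Finite.image2 _ Set.finite_univ htf
  have hPN : P ⊆ (N.subgroup : Set G) := by
    rintro _ ⟨i, -, g, hg, rfl⟩
    exact N.subgroup.mul_mem (hX i) (ht hg).2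
  obtain ⟨f, r, hf, hfr⟩ : ∃ (f : ℕ → G) (r : ℕ), (∀ i, f i ∈ P) ∧ ∀ a ∈ P, ∃ i < r, f i = a := by
    refine hP.exists_seq subset_rfl ?_
    have h0 : (0 : ℝ) ≤ δ' := by exact_mod_cast hδ'.le
    obtain ⟨g, hg, -⟩ := Set.mem_iUnion₂.1
      (hcov ⟨Metric.mem_closedBall_self h0, N.subgroup.one_mem⟩)
    exact ⟨_, ⟨0, hk⟩, trivial, g, hg, rfl⟩
  obtain ⟨w, hw, hwf⟩ := N.exists_val (.inl ()) f fun i => hPN (hf i)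
  have hval₁ : ∀ (v : HBall H m) (j : ℕ), (displFormula m j).eval π.toStr
      (Function.update w (.inr m, 0) v) = ‖π.toHom (f j) v.1 - v.1‖ := by
    intro v j
    exact eval_displFormula m j _ (f j) v
      ((Function.update_of_ne (by simp) _ _).trans (hwf j)) (Function.update_self _ _ _)
  have hval₂ : ∀ v : HBall H m, (nrmFormula m hm).eval π.toStr
      (Function.update w (.inr m, 0) v) = |1 - ‖v.1‖| :=
    fun v => eval_nrmFormula m hm _ v (Function.update_self _ _ _)
  obtain ⟨v, hv, hvε⟩ := hN.exists_mem_of_forall_exists w hw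
    (nrmFormula m hm :: (List.range r).map (displFormula m)) (.inr m) 0
    (fun θ hθ => by
      -- As `δ' ≤ δ`, all points of `P` lie in the translates `x_i K_δ`, so the hypothesis for the
      -- same `x_i` solves the system in `A(G, H)`.
      obtain ⟨v, hv1, hv2⟩ := h k m hk hm X θ hθ
      change HBall H m at v
      rw [UnitaryRep.nrm_toStr] at hv2
      refine ⟨v, fun ψ hψ => ?_⟩
      rcases List.mem_cons.1 hψ with rfl | hψ
      · exact (hval₂ v).trans_le hv2
      · obtain ⟨j, -, rfl⟩ := List.mem_map.1 hψ
        obtain ⟨i, -, g, hg, hig⟩ := hf j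
        refine (hval₁ v j).trans_le ?_
        have := hv1 (f j) (Set.mem_iUnion.2 ⟨i, g, ?_, hig.symm⟩)
        · exact (UnitaryRep.displ_toStr m (f j) v).symm.trans_le this
        · have h1 : dist g 1 ≤ (δ' : ℝ) := (ht hg).1
          rw [dist_comm] at h1
          exact h1.trans (by exact_mod_cast hδδ')) (ε / 2) (half_pos hε)
  change HBall H m at v
  refine ⟨⟨v, hv⟩, fun y hy => ?_, ?_⟩
  · obtain ⟨i, g, hg, rfl⟩ := Set.mem_iUnion.1 hy
    let z : G := g.1
    have hdispl : GH.displ N.toStr m (GH.mul N.toStr (x i) g) ⟨v, hv⟩ =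
        ‖π.toHom (X i * z) v.1 - v.1‖ :=
      CLSubstr.displ_mul_toStr (N := N) m (x i) g ⟨v, hv⟩
    have hg1 : dist (1 : G) z ≤ δ' :=
      (congrArg (fun y : G => dist y z) N.one_toStr).symm.trans_le hg
    rw [dist_comm] at hg1
    obtain ⟨c, hct, hc⟩ := Set.mem_iUnion₂.1 (hcov ⟨hg1, g.2⟩)
    obtain ⟨j, hj, hjc⟩ := hfr _ ⟨i, trivial, c, hct, rfl⟩
    have h1 := (hval₁ v j).symm.trans_le
      (hvε _ (List.mem_cons_of_mem _ (List.mem_map.2 ⟨j, List.mem_range.2 hj, rfl⟩)))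
    -- By left invariance `x_i z` is as close to `x_i c` as `z` is to `c`. Changing the group
    -- element costs `ε/2`, and the displacement at the net point is at most `ε/2`.
    have h2 := hηv (X i * z) (X i * c) (by rw [IsCLGroup.dist_mul_left]; exact hc) v.1 v.2
    refine hdispl.trans_le ?_
    rw [hjc] at h1
    beta_reduce at h1
    have h3 := norm_sub_le_norm_sub_add_norm_sub (π.toHom (X i * z) v.1)
      (π.toHom (X i * c) v.1) v.1
    linarith
  · have h1 := (hval₂ v).symm.trans_le (hvε _ List.mem_cons_self)
    refine (congrArg (fun z => |1 - z|)
      ((N.nrm_toStr m _).trans (UnitaryRep.nrm_toStr m v))).trans_le ?_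
    exact h1.trans (half_le_self hε.le)

end Transfer

/-! ### The main theorem -/

theorem mainTheorem4 (F : ℝ → ℝ) (hF : ∀ ε > 0, 0 < F ε)
    (G H : Type u) [Group G] [MetricSpace G] [IsCLGroup G]
    [NormedAddCommGroup H] [InnerProductSpace ℂ H] [CompleteSpace H]
    (π : UnitaryRep G H) (hπ : π.toStr ∈ KNIVUnion.{u} F) (hG : LocallyCompactSpace G)
    (N : CLSubstr π.toStr) (hN : N.IsElementary) :
    N.toStr ∈ KNIVUnion.{u} F ∧
    ∃ (G₀ : Subgroup G) (H₀ : Submodule ℂ H) (_ : IsCLGroup G₀) (_ : CompleteSpace H₀)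
      (π₀ : UnitaryRep G₀ H₀),
      -- `N` is the structure `A(G₀, H₀)` of the restricted action
      (∀ (g : G₀) (v : H₀), ((π₀.toHom g v : H₀) : H) = π.toHom (g : G) (v : H)) ∧
      (∃ e : MStr.Iso π₀.toStr N.toStr,
        (∀ g : G₀, ((e.toEquiv (.inl ()) g).1 : G) = (g : G)) ∧
        (∀ (n : ℕ) (v : HBall H₀ n),
          ((e.toEquiv (.inr n) v).1 : HBall H n).1 = ((v.1 : H₀) : H))) ∧
      -- `G₀ ≼ G` in the language of metric groups
      IsElementaryEmb (grpStr G₀) (grpStr G) (grpIncl G₀) ∧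
      -- `H₀ ≼ H` in the language of Hilbert spaces
      IsElementaryEmb (hilbStr H₀) (hilbStr H) (hilbIncl H₀) ∧
      LocallyCompactSpace G₀ := by
  have hG₀ : IsCLGroup N.subgroup := N.isCLGroup_subgroup
  have hH₀ : CompleteSpace N.subspace := hN.isClosed_subspace.completeSpace_coe
  refine ⟨?_, N.subgroup, N.subspace, hG₀, hH₀, N.rep, fun _ _ => rfl,
    ⟨hN.iso, fun _ => rfl, fun _ _ => rfl⟩, hN.grp_elementary, hN.hilb_elementary,
    N.isClosed_subgroup.isClosedEmbedding_subtypeVal.locallyCompactSpace⟩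
  obtain ⟨δ, ⟨hδ0, hδ1⟩, ⟨⟨⟨G', H', _, _, _, _, _, _, π', hH', ⟨e⟩⟩, hmod⟩, hinv⟩, hniv⟩ :=
    Set.mem_iUnion₂.1 hπ
  obtain ⟨r, hr, hrc⟩ := Metric.exists_isCompact_closedBall (1 : G)
  have hδ0' : (0 : ℝ) < δ := by exact_mod_cast hδ0
  -- Below `r` the ball `K_δ'` is compact; below `δ` almost invariance over `K_δ` covers it.
  obtain ⟨δ', h0, h1⟩ := exists_rat_btwn (lt_min hr hδ0')
  have hδ'0 : 0 < δ' := by exact_mod_cast h0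
  have hδ'δ : δ' ≤ δ := by exact_mod_cast (h1.le.trans (min_le_right _ _))
  -- Membership in the class only provides some isomorphic `A(G', H')` with `H'`
  -- infinite-dimensional, so this has to be carried back to `H`.
  have hH : ¬ FiniteDimensional ℂ H := fun _ => hH' (UnitaryRep.finiteDimensional_of_iso e)
  refine Set.mem_iUnion₂.2 ⟨δ', ⟨hδ'0, hδ'δ.trans_lt hδ1⟩,
    ⟨⟨⟨N.subgroup, N.subspace, inferInstance, inferInstance, hG₀, inferInstance, inferInstance,
      hH₀, N.rep, hN.not_finiteDimensional hH, ⟨hN.iso.symm⟩⟩, fun ε hε g h hgh v => ?_⟩, ?_⟩,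
    hN.NIV_toStr hniv⟩
  -- The modulus condition is universal, so it restricts to any substructure.
  · exact (congrArg₂ (fun a b : GH.Ball π.toStr 1 => dist a b) (N.act_toStr 1 g v)
      (N.act_toStr 1 h v)).trans_lt (hmod ε hε g.1 h.1 hgh v.1)
  · refine (almost_invariant_iff _ hδ'0).2 (hN.exists_almost_invariant hδ'0 hδ'δ ?_
      ((almost_invariant_iff _ hδ0).1 hinv))
    exact hrc.of_isClosed_subset Metric.isClosed_closedBall
      (Metric.closedBall_subset_closedBall (h1.le.trans (min_le_left _ _)))
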